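/- Let $\ell, k, i$ be integers with $0\le k\le \ell$ and $0\le i\le \ell$, and let $n\in\{2\ell,\,2\ell+1\}$. For $0\le j\le\lfloor n/2\rfloor$ let $\chi_{n,k}(j)$ denote the value of the irreducible complex character of the symmetric group $\mathfrak S_n$ indexed by the partition $(n-k,k)$ at a permutation of cycle type $2^j1^{n-2j}$, and define $\alpha_{n,k,i}$ by $$2^i\,\alpha_{n,k,i}=\sum_{j=0}^{i}\binom ij\,\chi_{n,k}(j).$$ Consider lattice paths from $(0,0)$ to $(n,n-2k)$ consisting of $n-k$ Up steps $(x,y)\to(x+1,y+1)$ and $k$ Down steps $(x,y)\to(x+1,y-1)$ that never go below the $x$-axis. A peak of such a path is a point of the path at which an Up step ends and a Down step starts; its height is its $y$-coordinate. For $d\ge 1$ let $s_d$ be the interval $(2d-2,2d)$ of the $x$-axis. (a) If $n=2\ell$, then $\alpha_{2\ell,k,i}$ is the number of those paths all of whose peaks of odd height have $x$-coordinate in one of the intervals $s_1,\dots,s_{\ell-i}$ (no peak of odd height is allowed if $i=\ell$). (b) If $n=2\ell+1$, then $\alpha_{2\ell+1,k,i}$ is likewise the number of those paths all of whose peaks of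 odd height have $x$-coordinate in one of the intervals $s_1,\dots,s_{\ell-i}$. -/

import Mathlib

namespace TwoRow

/-! ### Specht modules and the irreducible characters of the symmetric group -/

/-- A Young tableau of shape `μ` with entries `Fin n`, each used exactly once:
`t x` is the cell that holds the entry `x`. (There is none unless `μ.card = n`.) -/
abbrev Tableau (n : ℕ) (μ : YoungDiagram) : Type := Fin n ≃ μ.cells

/-- The row (counted from `0`) of the cell that holds `x`. -/
def Tableau.row {n : ℕ} {μ : YoungDiagram} (t : Tableau n μ) (x : Fin n) : ℕ := (t x).1.1

/-- The column (counted from `0`) of the cell that holds `x`. -/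
def Tableau.col {n : ℕ} {μ : YoungDiagram} (t : Tableau n μ) (x : Fin n) : ℕ := (t x).1.2

/-- Two tableaux of the same shape are row equivalent if and only if they have the same row
function, so a tabloid is recorded by its row function `Fin n → ℕ`. The symmetric group acts on
the free complex vector space on all functions `Fin n → ℕ` by moving the entries. -/
noncomputable def tabloidRep (n : ℕ) :
    Representation ℂ (Equiv.Perm (Fin n)) ((Fin n → ℕ) →₀ ℂ) where
  toFun σ := Finsupp.lmapDomain ℂ ℂ (fun r : Fin n → ℕ => r ∘ ⇑σ⁻¹)
  map_one' := by
    ext r : 1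
    ext
    simp
  map_mul' σ τ := by
    ext r : 1
    ext
    simp [Finsupp.mapDomain_single, Function.comp_assoc]

theorem tabloidRep_single (n : ℕ) (σ : Equiv.Perm (Fin n)) (r : Fin n → ℕ) (c : ℂ) :
    tabloidRep n σ (Finsupp.single r c) = Finsupp.single (r ∘ ⇑σ⁻¹) c := by
  simp [tabloidRep, Finsupp.mapDomain_single]

/-- The polytabloid of `t`: the signed sum of the images of the tabloid of `t` under the
column stabilizer of `t`. -/
noncomputable def polytabloid {n : ℕ} {μ : YoungDiagram} (t : Tableau n μ) :
    (Fin n → ℕ) →₀ ℂ :=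
  ∑ σ : Equiv.Perm (Fin n) with ∀ x, t.col (σ x) = t.col x,
    ((Equiv.Perm.sign σ : ℤ) : ℂ) • tabloidRep n σ (Finsupp.single t.row 1)

theorem tabloidRep_polytabloid {n : ℕ} {μ : YoungDiagram} (t : Tableau n μ)
    (τ : Equiv.Perm (Fin n)) :
    tabloidRep n τ (polytabloid t) = polytabloid (μ := μ) (τ⁻¹.trans t) := by
  unfold polytabloid
  rw [map_sum]
  refine Finset.sum_equiv (MulAut.conj τ).toEquiv ?_ ?_
  · intro σ
    rw [Finset.mem_filter_univ, Finset.mem_filter_univ]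
    constructor
    · intro h x
      simpa [Tableau.col] using h (τ⁻¹ x)
    · intro h x
      simpa [Tableau.col] using h (τ x)
  · intro σ _
    rw [map_smul]
    congr 1
    · simp [MulAut.conj_apply, mul_right_comm]
    · simp only [tabloidRep_single]
      congr 1
      ext x
      simp [Tableau.row]

/-- The Specht module of shape `μ` over `ℂ`, i.e. the span of the polytabloids. For `μ ⊢ n` this
is the irreducible representation of the symmetric group indexed by `μ`. -/
noncomputable def specht (n : ℕ) (μ : YoungDiagram) : Subrepresentation (tabloidRep n) where
  toSubmodule := Submodule.span ℂ (Set.range fun t : Tableau n μ => polytabloid t)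
  apply_mem_toSubmodule τ v hv := by
    have hle : Submodule.span ℂ (Set.range fun t : Tableau n μ => polytabloid t) ≤
        (Submodule.span ℂ (Set.range fun t : Tableau n μ => polytabloid t)).comap
          (tabloidRep n τ) := by
      rw [Submodule.span_le]
      rintro _ ⟨t, rfl⟩
      exact Submodule.subset_span ⟨τ⁻¹.trans t, (tabloidRep_polytabloid t τ).symm⟩
    exact hle hv

instance (n : ℕ) (μ : YoungDiagram) : FiniteDimensional ℂ (specht n μ).toSubmodule :=
  FiniteDimensional.span_of_finite ℂ (Set.finite_range _)

/-- The irreducible character of the symmetric group on `Fin n` indexed by `μ ⊢ n`: the trace of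
`σ` on the Specht module. -/
noncomputable def spechtChar (n : ℕ) (μ : YoungDiagram) (σ : Equiv.Perm (Fin n)) : ℂ :=
  LinearMap.trace ℂ (specht n μ).toSubmodule ((specht n μ).toRepresentation σ)

/-! ### Character values at involutions and the numbers `α` -/

/-- For `2 * j ≤ n`, the product `(0 1)(2 3) ⋯ (2j-2 2j-1)` of `j` disjoint transpositions. -/
def involFun (n j : ℕ) (x : Fin n) : Fin n :=
  if h : 2 * j ≤ n ∧ (x : ℕ) < 2 * j then
    if hx : (x : ℕ) % 2 = 0 then ⟨x + 1, by omega⟩ else ⟨x - 1, by omega⟩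
  else x

theorem involFun_involutive (n j : ℕ) : Function.Involutive (involFun n j) := by
  intro x
  have key : ∀ y : Fin n, (involFun n j y : ℕ) =
      if 2 * j ≤ n ∧ (y : ℕ) < 2 * j then
        if (y : ℕ) % 2 = 0 then (y : ℕ) + 1 else (y : ℕ) - 1
      else (y : ℕ) := by
    intro y
    unfold involFun
    split_ifs <;> rfl
  apply Fin.ext
  rw [key, key]
  split_ifs <;> omega

/-- A permutation with cycle type `2^j 1^(n-2j)`, for `2 * j ≤ n`. -/
def invol (n j : ℕ) : Equiv.Perm (Fin n) := (involFun_involutive n j).toPerm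

theorem cycleType_invol (n j : ℕ) (h : 2 * j ≤ n) :
    (invol n j).cycleType = Multiset.replicate j 2 := by
  have hsq : invol n j ^ 2 = 1 := by
    ext x
    simp [pow_two, invol, involFun_involutive n j x]
  have hall : ∀ m ∈ (invol n j).cycleType, m = 2 := by
    intro m hm
    have h1 : m ∣ 2 :=
      (Equiv.Perm.dvd_of_mem_cycleType hm).trans (orderOf_dvd_of_pow_eq_one hsq)
    exact le_antisymm (Nat.le_of_dvd two_pos h1) (Equiv.Perm.two_le_of_mem_cycleType hm)
  have hsupp : (invol n j).support = Finset.univ.filter fun x : Fin n => (x : ℕ) < 2 * j := by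
    ext x
    simp only [Equiv.Perm.mem_support, Finset.mem_filter, Finset.mem_univ, true_and, invol,
      Function.Involutive.coe_toPerm, involFun, ne_eq, Fin.ext_iff]
    split_ifs <;> simp <;> omega
  have hcard : (invol n j).support.card = 2 * j := by
    rw [hsupp, Fin.card_filter_val_lt, min_eq_right h]
  have hrep := Multiset.eq_replicate_card.2 hall
  have hsum := (invol n j).sum_cycleType
  rw [hcard, hrep, Multiset.sum_replicate, smul_eq_mul] at hsum
  rw [hrep]
  congr 1
  omega

/-- `α_{n,μ,i}`, defined by `2^i α_{n,μ,i} = ∑_{j=0}^i (i choose j) χ_μ(j)`, where `χ_μ(j)` is the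
value of the irreducible character `χ_μ` at a permutation with cycle type `2^j 1^(n-2j)`. -/
noncomputable def alphaShape (n : ℕ) (μ : YoungDiagram) (i : ℕ) : ℂ :=
  (∑ j ∈ Finset.range (i + 1), (i.choose j : ℂ) * spechtChar n μ (invol n j)) / 2 ^ i

/-- The Young diagram of the partition `(n-k, k)`. -/
def twoRow (n k : ℕ) (h : k ≤ n / 2) : YoungDiagram :=
  YoungDiagram.ofRowLens [n - k, k] (by
    rw [List.sortedGE_iff_pairwise]
    simp
    omega)

/-- `α_{n,k,i}`: the number `α_{n,μ,i}` for `μ = (n-k, k)`, with the convention that it is `0`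
if `k > ⌊n/2⌋` or `i > ⌊n/2⌋`. -/
noncomputable def alpha (n k i : ℕ) : ℂ :=
  if h : k ≤ n / 2 ∧ i ≤ n / 2 then alphaShape n (twoRow n k h.1) i else 0

/-! ### Nonnegative paths with restricted peaks -/

/-- The step of a path: Up from `(x, y)` to `(x+1, y+1)`, Down from `(x, y)` to `(x+1, y-1)`. -/
inductive Step
  | U
  | D
  deriving DecidableEq

instance : Fintype Step := ⟨{Step.U, Step.D}, by rintro (_ | _) <;> simp⟩

/-- The change of height made by a step. -/
def Step.rise : Step → ℤ
  | U => 1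
  | D => -1

/-- The ordinate at abscissa `x` of the path that starts at `(0, 0)` and has the steps `P`. -/
def height {n : ℕ} (P : Fin n → Step) (x : ℕ) : ℤ :=
  ∑ s : Fin n with s.val < x, (P s).rise

/-- The path stays on or above the `x`-axis. -/
def IsNonneg {n : ℕ} (P : Fin n → Step) : Prop := ∀ x ≤ n, 0 ≤ height P x

/-- The number of steps of a given kind. -/
def stepCount {n : ℕ} (P : Fin n → Step) (a : Step) : ℕ :=
  (Finset.univ.filter fun s => P s = a).card

/-- The path has a peak at abscissa `x`: an Up step ends there and a Down step starts there. -/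
def IsPeak {n : ℕ} (P : Fin n → Step) (x : ℕ) : Prop :=
  ∃ a b : Fin n, (a : ℕ) + 1 = x ∧ (b : ℕ) = x ∧ P a = Step.U ∧ P b = Step.D

/-- Every peak of odd height lies in one of the intervals `(2d-2, 2d)` with `d ∈ {1, …, m}`. -/
def OddPeaksIn {n : ℕ} (P : Fin n → Step) (m : ℕ) : Prop :=
  ∀ x, IsPeak P x → Odd (height P x) → ∃ d ∈ Finset.Icc 1 m, 2 * d < x + 2 ∧ x < 2 * d

/-- The nonnegative paths from `(0, 0)` to `(n, n-2k)` with `n-k` Up steps and `k` Down steps whose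
odd-height peaks lie only in the first `m` of the intervals `(0,2), (2,4), …`. -/
def restrictedPaths (n k m : ℕ) : Set (Fin n → Step) :=
  {P | height P n = (n : ℤ) - 2 * k ∧ stepCount P Step.U + k = n ∧ stepCount P Step.D = k ∧
    IsNonneg P ∧ OddPeaksIn P m}

end TwoRow

/-! Both sides are the coefficient of `X ^ k` in `(1 - X) * (1 + X) ^ (n - 2 * i) * (1 + X + X ^ 2)
^ i`.

Characters. Reading a tabloid as a monomial turns a two-row polytabloid into a product of `k`
differences of distinct variables. These products span the kernel of `D = ∑ ∂/∂X_a` on multilinear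
forms of degree `k` (`mem_pairProducts`, `map_specht`). With the raising operator `U`, `D` satisfies
an `sl₂` relation, so `D` maps degree `k` onto degree `k - 1` when `2k ≤ n`, split by `U` up to an
automorphism. Multilinear forms are a permutation module on `k`-subsets, so the character at `σ` is
the number of `σ`-fixed `k`-sets minus that of `σ`-fixed `(k-1)`-sets (`spechtChar_twoRow`). For `j`
transpositions the fixed sets have generating polynomial `(1 + X ^ 2) ^ j * (1 + X) ^ (n - 2 * j)`.
The binomial sum defining `α` then collapses because `(1 + X ^ 2) + (1 + X) ^ 2 = 2 * (1 + X + X ^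
2)` (`alpha_eq_coeff`).

Paths. Height and abscissa have the same parity, so the condition only forbids peaks at odd
abscissas beyond `2m`, where `m = ℓ - i`. Let `X` mark Down steps. Up to abscissa `2m` every step
contributes `1 + X`; afterwards the steps group into pairs, and forbidding Up-Down inside a pair
leaves `(1 + X) ^ 2 - X = 1 + X + X ^ 2`. The factor `1 - X` makes the two middle coefficients of a
palindromic polynomial cancel, so the coefficient at height `-1` is zero; this is the boundary
condition at the axis (`ncard_pathsTo_odd`, `ncard_pathsTo_even`). -/

namespace TwoRow

/-! ### Multilinear forms with their lowering and raising operators -/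

section Multilinear

set_option linter.unusedSectionVars false

open MvPolynomial

variable {ι K : Type*} [DecidableEq ι] [Field K]

variable (K) in
/-- The squarefree monomial with support `T`. -/
noncomputable def sqfreeMonomial (T : Finset ι) : MvPolynomial ι K := ∏ a ∈ T, X a

variable (K) in
/-- The multilinear forms of degree `k` in the variables from `A`. -/
noncomputable def multilinearForms (A : Finset ι) (k : ℕ) : Submodule K (MvPolynomial ι K) :=
  Submodule.span K (sqfreeMonomial K '' {T | T ⊆ A ∧ T.card = k})

theorem sqfreeMonomial_insert {a : ι} {T : Finset ι} (ha : a ∉ T) :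
    sqfreeMonomial K (insert a T) = X a * sqfreeMonomial K T :=
  Finset.prod_insert ha

theorem pderiv_sqfreeMonomial_of_notMem {a : ι} {T : Finset ι} (ha : a ∉ T) :
    pderiv a (sqfreeMonomial K T) = 0 := by
  induction T using Finset.induction with
  | empty => simp [sqfreeMonomial]
  | insert b S hb ih =>
    rw [Finset.mem_insert, not_or] at ha
    rw [sqfreeMonomial_insert hb, pderiv_mul, ih ha.2, pderiv_X_of_ne (Ne.symm ha.1)]
    simp

theorem pderiv_sqfreeMonomial_insert {a : ι} {T : Finset ι} (ha : a ∉ T) :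
    pderiv a (sqfreeMonomial K (insert a T)) = sqfreeMonomial K T := by
  rw [sqfreeMonomial_insert ha, pderiv_mul, pderiv_sqfreeMonomial_of_notMem ha, pderiv_X_self]
  simp

theorem sqfreeMonomial_mem {A T : Finset ι} {k : ℕ} (hT : T ⊆ A) (hk : T.card = k) :
    sqfreeMonomial K T ∈ multilinearForms K A k :=
  Submodule.subset_span ⟨T, ⟨hT, hk⟩, rfl⟩

theorem map_mem_of_sqfreeMonomial {V : Type*} [AddCommGroup V] [Module K V]
    (L : MvPolynomial ι K →ₗ[K] V) (W : Submodule K V) {A : Finset ι} {k : ℕ}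
    (h : ∀ T ⊆ A, T.card = k → L (sqfreeMonomial K T) ∈ W) {f : MvPolynomial ι K}
    (hf : f ∈ multilinearForms K A k) : L f ∈ W := by
  have : multilinearForms K A k ≤ W.comap L := by
    rw [multilinearForms, Submodule.span_le]
    rintro _ ⟨T, ⟨hT, hk⟩, rfl⟩
    exact h T hT hk
  exact this hf

theorem map_eq_of_sqfreeMonomial {V : Type*} [AddCommGroup V] [Module K V]
    (L L' : MvPolynomial ι K →ₗ[K] V) {A : Finset ι} {k : ℕ}
    (h : ∀ T ⊆ A, T.card = k → L (sqfreeMonomial K T) = L' (sqfreeMonomial K T))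
    {f : MvPolynomial ι K} (hf : f ∈ multilinearForms K A k) : L f = L' f := by
  have := map_mem_of_sqfreeMonomial (L - L') ⊥ (A := A) (k := k)
    (fun T hT hk => by simp [h T hT hk]) hf
  simpa [sub_eq_zero] using this

theorem multilinearForms_mono {A B : Finset ι} (h : A ⊆ B) (k : ℕ) :
    multilinearForms K A k ≤ multilinearForms K B k :=
  Submodule.span_mono (Set.image_mono fun _ hT => ⟨hT.1.trans h, hT.2⟩)

theorem multilinearForms_eq_bot {A : Finset ι} {k : ℕ} (h : A.card < k) :
    multilinearForms K A k = ⊥ := by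
  rw [multilinearForms, Submodule.span_eq_bot]
  rintro _ ⟨T, ⟨hT, hk⟩, rfl⟩
  have := Finset.card_le_card hT
  omega

variable (ι K) in
/-- The derivation `∑ ∂/∂X_a`: it sends a squarefree monomial to the sum of its maximal proper
divisors. -/
noncomputable def lowering : Derivation K (MvPolynomial ι K) (MvPolynomial ι K) :=
  mkDerivation K fun _ => 1

@[simp]
theorem lowering_X (a : ι) : lowering ι K (X a) = 1 := mkDerivation_X _ _ _

/-- The commutator of two derivations is a derivation, and this one vanishes on the variables
because both take constant values there. -/
theorem lowering_pderiv (a : ι) (f : MvPolynomial ι K) :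
    lowering ι K (pderiv a f) = pderiv a (lowering ι K f) := by
  have : ⁅lowering ι K, (pderiv a : Derivation K (MvPolynomial ι K) (MvPolynomial ι K))⁆ = 0 := by
    apply MvPolynomial.derivation_ext
    intro b
    by_cases h : b = a
    · subst h
      simp [Derivation.commutator_apply]
    · simp [Derivation.commutator_apply, pderiv_X_of_ne h]
  have h := congrArg (fun E : Derivation K (MvPolynomial ι K) (MvPolynomial ι K) => E f) this
  simpa [Derivation.commutator_apply, sub_eq_zero] using h

theorem lowering_sqfreeMonomial_mem (T : Finset ι) :
    ∀ k, T.card = k + 1 → lowering ι K (sqfreeMonomial K T) ∈ multilinearForms K T k := by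
  induction T using Finset.induction with
  | empty => simp
  | insert a S ha ih =>
    intro k hk
    rw [Finset.card_insert_of_notMem ha, Nat.add_right_cancel_iff] at hk
    rw [sqfreeMonomial_insert ha, Derivation.leibniz, lowering_X, smul_eq_mul, smul_eq_mul, mul_one]
    refine Submodule.add_mem _ ?_ (sqfreeMonomial_mem (Finset.subset_insert a S) hk)
    cases k with
    | zero =>
      rw [Finset.card_eq_zero] at hk
      subst hk
      simp [sqfreeMonomial]
    | succ k =>
      refine map_mem_of_sqfreeMonomial (LinearMap.mulLeft K (X a)) _ (fun T hT hT' => ?_) (ih k hk)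
      have haT : a ∉ T := fun h => ha (hT h)
      rw [LinearMap.mulLeft_apply, ← sqfreeMonomial_insert haT]
      exact sqfreeMonomial_mem (Finset.insert_subset_insert a hT)
        (by rw [Finset.card_insert_of_notMem haT, hT'])

theorem lowering_mem {A : Finset ι} {k : ℕ} {f : MvPolynomial ι K}
    (hf : f ∈ multilinearForms K A (k + 1)) : lowering ι K f ∈ multilinearForms K A k :=
  map_mem_of_sqfreeMonomial (lowering ι K).toLinearMap _
    (fun T hT hk => multilinearForms_mono hT k (lowering_sqfreeMonomial_mem T k hk)) hf

theorem lowering_eq_zero {A : Finset ι} {f : MvPolynomial ι K}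
    (hf : f ∈ multilinearForms K A 0) : lowering ι K f = 0 :=
  map_eq_of_sqfreeMonomial (lowering ι K).toLinearMap 0
    (fun T _ hk => by rw [Finset.card_eq_zero] at hk; simp [hk, sqfreeMonomial]) hf

/-- The operator `∑_{a ∈ A} (X_a - X_a² ∂/∂X_a)`: it sends a squarefree monomial in the variables
from `A` to the sum of its products with the variables from `A` that do not divide it. -/
noncomputable def raising (A : Finset ι) : MvPolynomial ι K →ₗ[K] MvPolynomial ι K :=
  ∑ a ∈ A, (LinearMap.mulLeft K (X a) - LinearMap.mulLeft K (X a ^ 2) ∘ₗ (pderiv a).toLinearMap)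

theorem raising_apply (A : Finset ι) (f : MvPolynomial ι K) :
    raising A f = ∑ a ∈ A, (X a * f - X a ^ 2 * pderiv a f) := by
  simp [raising]

theorem raising_mem {A : Finset ι} {k : ℕ} {f : MvPolynomial ι K}
    (hf : f ∈ multilinearForms K A k) : raising A f ∈ multilinearForms K A (k + 1) := by
  refine map_mem_of_sqfreeMonomial (raising A) _ (fun T hT hk => ?_) hf
  rw [raising_apply]
  refine Submodule.sum_mem _ fun a ha => ?_
  by_cases haT : a ∈ T
  · rw [← Finset.insert_erase haT, pderiv_sqfreeMonomial_insert (Finset.notMem_erase a T),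
      sqfreeMonomial_insert (Finset.notMem_erase a T), ← mul_assoc, ← pow_two, sub_self]
    exact Submodule.zero_mem _
  · rw [pderiv_sqfreeMonomial_of_notMem haT, mul_zero, sub_zero, ← sqfreeMonomial_insert haT]
    exact sqfreeMonomial_mem (Finset.insert_subset ha hT)
      (by rw [Finset.card_insert_of_notMem haT, hk])

theorem euler_multilinearForms {A : Finset ι} {k : ℕ} {f : MvPolynomial ι K}
    (hf : f ∈ multilinearForms K A k) : ∑ a ∈ A, X a * pderiv a f = (k : K) • f := by
  have := map_eq_of_sqfreeMonomial
    (∑ a ∈ A, LinearMap.mulLeft K (X a) ∘ₗ (pderiv a).toLinearMap) ((k : K) • LinearMap.id)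
    (fun T hT hk => ?_) hf
  · simpa using this
  · have h : ∀ a ∈ A, X a * pderiv a (sqfreeMonomial K T) =
        if a ∈ T then sqfreeMonomial K T else 0 := by
      intro a _
      split_ifs with haT
      · conv_lhs => rw [← Finset.insert_erase haT]
        rw [pderiv_sqfreeMonomial_insert (Finset.notMem_erase a T),
          ← sqfreeMonomial_insert (Finset.notMem_erase a T), Finset.insert_erase haT]
      · rw [pderiv_sqfreeMonomial_of_notMem haT, mul_zero]
    simp only [LinearMap.coe_sum, Finset.sum_apply, LinearMap.comp_apply, LinearMap.mulLeft_apply,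
      Derivation.coeFn_coe, LinearMap.smul_apply, LinearMap.id_apply]
    rw [Finset.sum_congr rfl h, ← Finset.sum_filter, Finset.sum_const,
      Finset.filter_mem_eq_inter, Finset.inter_eq_right.2 hT, hk, Nat.cast_smul_eq_nsmul]

/-- The commutation relation of the lowering and the raising operator. -/
theorem lowering_raising {A : Finset ι} {k : ℕ} {f : MvPolynomial ι K}
    (hf : f ∈ multilinearForms K A k) :
    lowering ι K (raising A f) =
      raising A (lowering ι K f) + ((A.card : K) - 2 * (k : K)) • f := by
  -- Summed over `A`, the correction terms give `|A| • f - 2 • ∑ X_a ∂_a f`, and Euler's identity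
  -- evaluates the last sum as `k • f`.
  have h : ∀ a ∈ A, lowering ι K (X a * f - X a ^ 2 * pderiv a f) =
      (X a * lowering ι K f - X a ^ 2 * pderiv a (lowering ι K f)) +
        (f - (2 : K) • (X a * pderiv a f)) := by
    intro a _
    rw [map_sub, Derivation.leibniz, Derivation.leibniz, Derivation.leibniz_pow, lowering_X,
      lowering_pderiv, ofNat_smul_eq_nsmul K 2]
    simp only [smul_eq_mul, nsmul_eq_mul]
    push_cast
    ring
  rw [raising_apply, map_sum, Finset.sum_congr rfl h, Finset.sum_add_distrib, ← raising_apply,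
    Finset.sum_sub_distrib, ← Finset.smul_sum, euler_multilinearForms hf, Finset.sum_const,
    smul_smul, sub_smul, Nat.cast_smul_eq_nsmul]

variable [CharZero K]

/-- Above the middle, `DU + c` is injective for `c > 0`, by descending induction on the degree (`r`
measures the distance to degree `|A| + 1`, where no forms are left). Applying `U` to `DUf + cf = 0`
and commuting gives the same kind of equation for `Uf`, with constant `c + (2k + 2 - |A|)`, still
positive. Hence `Uf = 0`, so `cf = 0`. -/
theorem eq_zero_of_lowering_raising_add_smul {A : Finset ι} :
    ∀ (r k : ℕ), A.card + 1 = k + r → A.card ≤ 2 * k + 2 → ∀ (c : ℕ), 0 < c →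
      ∀ f ∈ multilinearForms K A k, lowering ι K (raising A f) + (c : K) • f = 0 → f = 0 := by
  intro r
  induction r with
  | zero =>
    intro k hk _ c _ f hf _
    rw [multilinearForms_eq_bot (by omega)] at hf
    simpa using hf
  | succ r ih =>
    intro k hk hk2 c hc f hf h
    have hU := raising_mem hf
    have h2 := lowering_raising hU
    have h3 := congrArg (raising A) h
    rw [map_add, map_smul, map_zero] at h3
    have h4 : raising A f = 0 := by
      refine ih (k + 1) (by omega) (by omega) (c + (2 * k + 2 - A.card)) (by omega) _ hU ?_
      rw [h2, ← h3, Nat.cast_add c, Nat.cast_sub hk2]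
      push_cast
      module
    rw [h4, map_zero, zero_add] at h
    exact (smul_eq_zero.1 h).resolve_left (Nat.cast_ne_zero.2 hc.ne')

/-- The mirror image below the middle, by ascending induction: applying `D` gives the equation for
`Df`, one degree lower, with a constant that does not decrease. -/
theorem eq_zero_of_raising_lowering_add_smul {A : Finset ι} :
    ∀ (k : ℕ), 2 * k ≤ A.card + 2 → ∀ (c : ℕ), 0 < c →
      ∀ f ∈ multilinearForms K A k, raising A (lowering ι K f) + (c : K) • f = 0 → f = 0 := by
  intro k
  induction k with
  | zero =>
    intro _ c hc f hf h
    rw [lowering_eq_zero hf, map_zero, zero_add] at h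
    exact (smul_eq_zero.1 h).resolve_left (Nat.cast_ne_zero.2 hc.ne')
  | succ k ih =>
    intro hk c hc f hf h
    have hD := lowering_mem hf
    have h2 := lowering_raising hD
    have h3 := congrArg (lowering ι K) h
    rw [map_add, Derivation.map_smul, map_zero] at h3
    have h4 : lowering ι K f = 0 := by
      refine ih (by omega) (c + (A.card - 2 * k)) (by omega) _ hD ?_
      rw [← h3, h2, Nat.cast_add c, Nat.cast_sub (by omega)]
      push_cast
      module
    rw [h4, map_zero, zero_add] at h
    exact (smul_eq_zero.1 h).resolve_left (Nat.cast_ne_zero.2 hc.ne')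

theorem eq_zero_of_lowering_eq_zero {A : Finset ι} {k : ℕ} (hk : A.card < 2 * k)
    {f : MvPolynomial ι K} (hf : f ∈ multilinearForms K A k) (h : lowering ι K f = 0) : f = 0 := by
  by_cases hA : k ≤ A.card + 1
  -- When `Df = 0` the commutation relation reads `DUf + (2k - |A|) f = 0`, with positive constant.
  · refine eq_zero_of_lowering_raising_add_smul (A.card + 1 - k) k (by omega) (by omega)
      (2 * k - A.card) (by omega) f hf ?_
    rw [lowering_raising hf, h, map_zero, Nat.cast_sub hk.le]
    push_cast
    module
  · rw [multilinearForms_eq_bot (by omega)] at hf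
    simpa using hf

theorem eq_zero_of_lowering_raising_eq_zero {A : Finset ι} {k : ℕ} (hk : 2 * k < A.card)
    {f : MvPolynomial ι K} (hf : f ∈ multilinearForms K A k)
    (h : lowering ι K (raising A f) = 0) : f = 0 := by
  refine eq_zero_of_raising_lowering_add_smul k (by omega) (A.card - 2 * k) (by omega) f hf ?_
  rw [← h, lowering_raising hf, Nat.cast_sub hk.le]
  push_cast
  rfl

end Multilinear

/-! ### Products of differences span the kernel of the lowering operator -/

section PairProducts

set_option linter.unusedSectionVars false

open MvPolynomial

variable {ι K : Type*} [DecidableEq ι] [Field K]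

/-- `a` and `b` list `2 * k` different elements of `A`. -/
def IsPairing {k : ℕ} (A : Finset ι) (a b : Fin k → ι) : Prop :=
  Function.Injective (Sum.elim a b) ∧ ∀ i, Sum.elim a b i ∈ A

variable (K) in
/-- The product of the differences `X_(b i) - X_(a i)`. -/
noncomputable def pairProduct {k : ℕ} (a b : Fin k → ι) : MvPolynomial ι K :=
  ∏ i, (X (b i) - X (a i))

variable (K) in
/-- The span of the products of `k` differences in `2 * k` different variables from `A`. -/
noncomputable def pairProducts (A : Finset ι) (k : ℕ) : Submodule K (MvPolynomial ι K) :=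
  Submodule.span K {q | ∃ a b : Fin k → ι, IsPairing A a b ∧ pairProduct K a b = q}

theorem IsPairing.mono {k : ℕ} {A B : Finset ι} {a b : Fin k → ι} (h : IsPairing A a b)
    (hAB : A ⊆ B) : IsPairing B a b :=
  ⟨h.1, fun i => hAB (h.2 i)⟩

theorem pairProducts_mono {A B : Finset ι} (h : A ⊆ B) (k : ℕ) :
    pairProducts K A k ≤ pairProducts K B k :=
  Submodule.span_mono fun _ ⟨a, b, hab, hq⟩ => ⟨a, b, hab.mono h, hq⟩

theorem IsPairing.tail {k : ℕ} {A : Finset ι} {a b : Fin (k + 1) → ι} (h : IsPairing A a b) :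
    IsPairing ((A.erase (a 0)).erase (b 0)) (Fin.tail a) (Fin.tail b) := by
  have h1 : Sum.elim (Fin.tail a) (Fin.tail b) = Sum.elim a b ∘ Sum.map Fin.succ Fin.succ := by
    ext (i | i) <;> rfl
  rw [IsPairing, h1]
  refine ⟨h.1.comp (Sum.map_injective.2 ⟨Fin.succ_injective _, Fin.succ_injective _⟩), fun i => ?_⟩
  refine Finset.mem_erase.2 ⟨?_, Finset.mem_erase.2 ⟨?_, h.2 _⟩⟩
  · exact h.1.ne (a₂ := Sum.inr 0) (by rcases i with i | i <;> simp)
  · exact h.1.ne (a₂ := Sum.inl 0) (by rcases i with i | i <;> simp)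

theorem IsPairing.cons {k : ℕ} {A : Finset ι} {a b : Fin k → ι} (h : IsPairing A a b) {x c : ι}
    (hx : x ∉ A) (hc : c ∈ A) (hab : ∀ i, Sum.elim a b i ≠ c) :
    IsPairing (insert x A) (Fin.cons x a : Fin (k + 1) → ι) (Fin.cons c b) := by
  have ha : ∀ i, a i ∈ A := fun i => h.2 (Sum.inl i)
  have hb : ∀ i, b i ∈ A := fun i => h.2 (Sum.inr i)
  constructor
  · refine Function.Injective.sumElim ?_ ?_ ?_
    · rw [Fin.cons_injective_iff]
      refine ⟨?_, h.1.comp Sum.inl_injective⟩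
      rintro ⟨i, rfl⟩
      exact hx (ha i)
    · rw [Fin.cons_injective_iff]
      refine ⟨?_, h.1.comp Sum.inr_injective⟩
      rintro ⟨i, hi⟩
      exact hab (Sum.inr i) hi
    · intro i j
      refine Fin.cases ?_ (fun i => ?_) i <;> refine Fin.cases ?_ (fun j => ?_) j
      · rintro rfl
        exact hx hc
      · intro hij
        have hxj : x = b j := hij
        exact hx (hxj ▸ hb j)
      · exact hab (Sum.inl i)
      · exact h.1.ne (a₁ := Sum.inl i) (a₂ := Sum.inr j) (by simp)
  · rintro (i | i) <;> refine Fin.cases ?_ (fun i => ?_) i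
    · exact Finset.mem_insert_self _ _
    · exact Finset.mem_insert_of_mem (ha i)
    · exact Finset.mem_insert_of_mem hc
    · exact Finset.mem_insert_of_mem (hb i)

theorem pairProduct_succ {k : ℕ} (a b : Fin (k + 1) → ι) :
    pairProduct K a b = (X (b 0) - X (a 0)) * pairProduct K (Fin.tail a) (Fin.tail b) :=
  Fin.prod_univ_succ _

theorem X_mul_mem {A : Finset ι} {k : ℕ} {x : ι} (hx : x ∉ A) {f : MvPolynomial ι K}
    (hf : f ∈ multilinearForms K A k) : X x * f ∈ multilinearForms K (insert x A) (k + 1) := by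
  refine map_mem_of_sqfreeMonomial (LinearMap.mulLeft K (X x)) _ (fun T hT hk => ?_) hf
  have hxT : x ∉ T := fun h => hx (hT h)
  rw [LinearMap.mulLeft_apply, ← sqfreeMonomial_insert hxT]
  exact sqfreeMonomial_mem (Finset.insert_subset_insert x hT)
    (by rw [Finset.card_insert_of_notMem hxT, hk])

theorem pairProduct_mem {k : ℕ} : ∀ {A : Finset ι} {a b : Fin k → ι}, IsPairing A a b →
    pairProduct K a b ∈ multilinearForms K A k := by
  induction k with
  | zero =>
    intro A a b _
    have := sqfreeMonomial_mem (K := K) (Finset.empty_subset A) Finset.card_empty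
    simpa [pairProduct, sqfreeMonomial] using this
  | succ k ih =>
    intro A a b h
    have h1 := ih h.tail
    rw [pairProduct_succ, sub_mul]
    refine Submodule.sub_mem _ ?_ ?_
    · refine multilinearForms_mono ?_ _ (X_mul_mem (Finset.notMem_erase _ _) h1)
      refine Finset.insert_subset (h.2 (Sum.inr 0)) ?_
      exact (Finset.erase_subset _ _).trans (Finset.erase_subset _ _)
    · rw [Finset.erase_right_comm] at h1
      refine multilinearForms_mono ?_ _ (X_mul_mem (Finset.notMem_erase _ _) h1)
      refine Finset.insert_subset (h.2 (Sum.inl 0)) ?_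
      exact (Finset.erase_subset _ _).trans (Finset.erase_subset _ _)

theorem lowering_pairProduct {k : ℕ} (a b : Fin k → ι) : lowering ι K (pairProduct K a b) = 0 := by
  induction k with
  | zero => simp [pairProduct]
  | succ k ih => rw [pairProduct_succ, Derivation.leibniz, ih, map_sub, lowering_X, lowering_X]; simp

theorem pairProducts_le (A : Finset ι) (k : ℕ) :
    pairProducts K A k ≤ multilinearForms K A k := by
  rw [pairProducts, Submodule.span_le]
  rintro _ ⟨a, b, h, rfl⟩
  exact pairProduct_mem h

theorem lowering_eq_zero_of_mem_pairProducts {A : Finset ι} {k : ℕ} {f : MvPolynomial ι K}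
    (hf : f ∈ pairProducts K A k) : lowering ι K f = 0 := by
  have : pairProducts K A k ≤ LinearMap.ker (lowering ι K).toLinearMap := by
    rw [pairProducts, Submodule.span_le]
    rintro _ ⟨a, b, -, rfl⟩
    exact lowering_pairProduct a b
  exact this hf

theorem pderiv_mem {A : Finset ι} {k : ℕ} {x : ι} {f : MvPolynomial ι K}
    (hf : f ∈ multilinearForms K (insert x A) (k + 1)) :
    pderiv x f ∈ multilinearForms K A k := by
  refine map_mem_of_sqfreeMonomial (pderiv x).toLinearMap _ (fun T hT hk => ?_) hf
  rw [Derivation.coeFn_coe]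
  by_cases hxT : x ∈ T
  · rw [← Finset.insert_erase hxT, pderiv_sqfreeMonomial_insert (Finset.notMem_erase x T)]
    exact sqfreeMonomial_mem (by rwa [← Finset.subset_insert_iff])
      (by rw [Finset.card_erase_of_mem hxT, hk, Nat.add_sub_cancel])
  · rw [pderiv_sqfreeMonomial_of_notMem hxT]
    exact Submodule.zero_mem _

theorem sub_X_mul_pderiv_mem {A : Finset ι} {k : ℕ} {x : ι} {f : MvPolynomial ι K}
    (hf : f ∈ multilinearForms K (insert x A) k) :
    f - X x * pderiv x f ∈ multilinearForms K A k := by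
  refine map_mem_of_sqfreeMonomial
    (LinearMap.id - LinearMap.mulLeft K (X x) ∘ₗ (pderiv x).toLinearMap) _ (fun T hT hk => ?_) hf
  simp only [LinearMap.sub_apply, LinearMap.id_apply, LinearMap.comp_apply,
    LinearMap.mulLeft_apply, Derivation.coeFn_coe]
  by_cases hxT : x ∈ T
  · rw [← Finset.insert_erase hxT, pderiv_sqfreeMonomial_insert (Finset.notMem_erase x T),
      sqfreeMonomial_insert (Finset.notMem_erase x T), sub_self]
    exact Submodule.zero_mem _
  · rw [pderiv_sqfreeMonomial_of_notMem hxT, mul_zero, sub_zero]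
    exact sqfreeMonomial_mem ((Finset.subset_insert_iff_of_notMem hxT).1 hT) hk

/-- A pairing uses `2k < |A|` elements, so some `c` in `A` is free. Then `X_x q = -(X_c - X_x) q +
X_c q`, where the first term is a longer product of differences and the second no longer involves
`x`. -/
theorem X_mul_mem_sup {A : Finset ι} {k : ℕ} (hk : 2 * k < A.card) {x : ι} (hx : x ∉ A)
    {f : MvPolynomial ι K} (hf : f ∈ pairProducts K A k) :
    X x * f ∈ pairProducts K (insert x A) (k + 1) ⊔ multilinearForms K A (k + 1) := by
  have : pairProducts K A k ≤ (pairProducts K (insert x A) (k + 1) ⊔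
      multilinearForms K A (k + 1)).comap (LinearMap.mulLeft K (X x)) := by
    rw [pairProducts, Submodule.span_le]
    rintro _ ⟨a, b, h, rfl⟩
    obtain ⟨c, hc, hab⟩ : ∃ c ∈ A, c ∉ Finset.univ.image (Sum.elim a b) := by
      apply Finset.exists_mem_notMem_of_card_lt_card
      refine Finset.card_image_le.trans_lt ?_
      simp
      omega
    have hab : ∀ i, Sum.elim a b i ≠ c := fun i hi =>
      hab (Finset.mem_image.2 ⟨i, Finset.mem_univ _, hi⟩)
    have h1 : X x * pairProduct K a b =
        -pairProduct K (Fin.cons x a : Fin (k + 1) → ι) (Fin.cons c b) +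
          X c * pairProduct K a b := by
      rw [pairProduct_succ]
      simp only [Fin.cons_zero, Fin.tail_cons]
      ring
    rw [SetLike.mem_coe, Submodule.mem_comap, LinearMap.mulLeft_apply, h1]
    refine Submodule.add_mem_sup (Submodule.neg_mem _ ?_) ?_
    · exact Submodule.subset_span ⟨_, _, h.cons hx hc hab, rfl⟩
    · rw [← Finset.insert_erase hc]
      exact X_mul_mem (Finset.notMem_erase c A)
        (pairProduct_mem ⟨h.1, fun i => Finset.mem_erase.2 ⟨hab i, h.2 i⟩⟩)
  exact this hf

theorem multilinearForms_zero_le (A : Finset ι) : multilinearForms K A 0 ≤ pairProducts K A 0 := by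
  rw [multilinearForms, Submodule.span_le]
  rintro _ ⟨T, ⟨-, hT⟩, rfl⟩
  rw [Finset.card_eq_zero] at hT
  subst hT
  refine Submodule.subset_span ⟨Fin.elim0, Fin.elim0, ⟨?_, ?_⟩, ?_⟩
  · rintro (i | i) <;> exact i.elim0
  · rintro (i | i) <;> exact i.elim0
  · simp [pairProduct, sqfreeMonomial]

/-- The multilinear forms of degree `k` killed by the lowering operator are spanned by products of
differences of variables. -/
theorem mem_pairProducts [CharZero K] (A : Finset ι) : ∀ {k : ℕ}, 2 * k ≤ A.card →
    ∀ {f : MvPolynomial ι K}, f ∈ multilinearForms K A k → lowering ι K f = 0 →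
      f ∈ pairProducts K A k := by
  induction A using Finset.induction with
  | empty =>
    intro k hk f hf _
    obtain rfl : k = 0 := by simpa using hk
    exact multilinearForms_zero_le _ hf
  | insert x A hx ih =>
    intro k hk f hf h0
    rw [Finset.card_insert_of_notMem hx] at hk
    cases k with
    | zero => exact multilinearForms_zero_le _ hf
    | succ k =>
      -- The coefficient `∂f/∂X_x` is itself killed by `D`, so induction applies to it. Modulo
      -- products of differences this eliminates `X_x` from `f`.
      have h1 := ih (by omega) (pderiv_mem hf) (by rw [lowering_pderiv, h0, map_zero])
      have h2 : f ∈ pairProducts K (insert x A) (k + 1) ⊔ multilinearForms K A (k + 1) := by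
        rw [← sub_add_cancel f (X x * pderiv x f)]
        exact Submodule.add_mem _ (Submodule.mem_sup_right (sub_X_mul_pderiv_mem hf))
          (X_mul_mem_sup (by omega) hx h1)
      obtain ⟨s, hs, g, hg, rfl⟩ := Submodule.mem_sup.1 h2
      rw [map_add, lowering_eq_zero_of_mem_pairProducts hs, zero_add] at h0
      refine Submodule.add_mem _ hs ?_
      -- The remainder `g` lives on `A` and is killed by `D`: induction handles it, unless its
      -- degree is above the middle of `A`, where `D` is injective and `g = 0`.
      by_cases hA : 2 * (k + 1) ≤ A.card
      · exact pairProducts_mono (Finset.subset_insert x A) _ (ih hA hg h0)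
      · rw [eq_zero_of_lowering_eq_zero (by omega) hg h0]
        exact Submodule.zero_mem _

end PairProducts

/-! ### Two-row Specht modules as spaces of polynomials -/

section Tabloids

open MvPolynomial

/-- The tabloid with row function `r`, as the monomial with exponents `r`. -/
noncomputable def tabloidPoly (n : ℕ) : ((Fin n → ℕ) →₀ ℂ) ≃ₗ[ℂ] MvPolynomial (Fin n) ℂ :=
  (Finsupp.domLCongr Finsupp.equivFunOnFinite.symm).trans (basisMonomials (Fin n) ℂ).repr.symm

theorem tabloidPoly_single {n : ℕ} (r : Fin n → ℕ) :
    tabloidPoly n (Finsupp.single r 1) = ∏ x, X x ^ r x := by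
  rw [tabloidPoly, LinearEquiv.trans_apply, Finsupp.domLCongr_single,
    Module.Basis.repr_symm_single_one, coe_basisMonomials]
  dsimp only
  rw [monomial_eq, C_1, one_mul, Finsupp.prod_fintype _ _ (fun _ => pow_zero _)]
  rfl

theorem tabloidPoly_tabloidRep {n : ℕ} (σ : Equiv.Perm (Fin n)) (v : (Fin n → ℕ) →₀ ℂ) :
    tabloidPoly n (tabloidRep n σ v) = rename σ (tabloidPoly n v) := by
  have : (tabloidPoly n).toLinearMap ∘ₗ tabloidRep n σ =
      (rename σ).toLinearMap ∘ₗ (tabloidPoly n).toLinearMap := by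
    ext r : 2
    simp only [LinearMap.comp_apply, Finsupp.lsingle_apply, LinearEquiv.coe_coe,
      tabloidRep_single, tabloidPoly_single, AlgHom.toLinearMap_apply, map_prod, map_pow, rename_X]
    refine (Fintype.prod_equiv σ _ _ fun x => ?_).symm
    simp
  exact LinearMap.congr_fun this v

theorem mem_twoRow {n k : ℕ} {h : k ≤ n / 2} {c : ℕ × ℕ} :
    c ∈ (twoRow n k h).cells ↔ (c.1 = 0 ∧ c.2 < n - k) ∨ (c.1 = 1 ∧ c.2 < k) := by
  obtain ⟨r, c⟩ := c
  rw [YoungDiagram.mem_cells, twoRow, YoungDiagram.mem_ofRowLens]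
  match r with
  | 0 => simp
  | 1 => simp
  | r + 2 => simp

theorem card_twoRow {n k : ℕ} {h : k ≤ n / 2} : (twoRow n k h).cells.card = n := by
  have : (twoRow n k h).cells =
      ({0} : Finset ℕ) ×ˢ Finset.range (n - k) ∪ ({1} : Finset ℕ) ×ˢ Finset.range k := by
    ext c
    rw [mem_twoRow, Finset.mem_union, Finset.mem_product, Finset.mem_product]
    simp only [Finset.mem_singleton, Finset.mem_range]
  rw [this, Finset.card_union_of_disjoint]
  · simp
    omega
  · rw [Finset.disjoint_left]
    simp

/-- The matrix whose determinant is the image of the polytabloid of `t`. -/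
noncomputable def columnMatrix {n : ℕ} {μ : YoungDiagram} (t : Tableau n μ) :
    Matrix (Fin n) (Fin n) (MvPolynomial (Fin n) ℂ) :=
  Matrix.of fun x y => if t.col x = t.col y then X x ^ t.row y else 0

/-- This is the Leibniz expansion: a permutation outside the column stabilizer meets a zero entry,
the others give the terms of the polytabloid. -/
theorem tabloidPoly_polytabloid_eq_det {n : ℕ} {μ : YoungDiagram} (t : Tableau n μ) :
    tabloidPoly n (polytabloid t) = (columnMatrix t).det := by
  rw [polytabloid, map_sum, Matrix.det_apply, Finset.sum_filter]
  refine Finset.sum_congr rfl fun σ _ => ?_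
  split_ifs with h
  · rw [map_smul, tabloidPoly_tabloidRep, tabloidPoly_single, map_prod, Units.smul_def,
      Int.cast_smul_eq_zsmul]
    congr 1
    exact Finset.prod_congr rfl fun x _ => by simp [columnMatrix, h x]
  · obtain ⟨x, hx⟩ := not_forall.1 h
    rw [Finset.prod_eq_zero (Finset.mem_univ x), smul_zero]
    simp [columnMatrix, hx]

theorem columnMatrix_det {n : ℕ} {μ : YoungDiagram} (t : Tableau n μ) :
    (columnMatrix t).det =
      ∏ c ∈ Finset.univ.image t.col, ((columnMatrix t).toSquareBlock t.col c).det := by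
  apply Matrix.BlockTriangular.det
  intro x y h
  simp [columnMatrix, h.ne']

theorem Tableau.ext_cell {n : ℕ} {μ : YoungDiagram} (t : Tableau n μ) {x y : Fin n}
    (hr : t.row x = t.row y) (hc : t.col x = t.col y) : x = y :=
  t.injective (Subtype.ext (Prod.ext hr hc))

/-- A column with two cells gives the Vandermonde matrix with rows `(1, X_a)` and `(1, X_b)`. -/
theorem det_toSquareBlock_of_two {n : ℕ} {μ : YoungDiagram} (t : Tableau n μ) {a b : Fin n} {c : ℕ}
    (ha : t.row a = 0 ∧ t.col a = c) (hb : t.row b = 1 ∧ t.col b = c)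
    (h : ∀ x, t.col x = c → t.row x = 0 ∨ t.row x = 1) :
    ((columnMatrix t).toSquareBlock t.col c).det = X b - X a := by
  have hbij : Function.Bijective
      (![⟨a, ha.2⟩, ⟨b, hb.2⟩] : Fin 2 → {x // t.col x = c}) := by
    constructor
    · have hab : a ≠ b := by
        rintro rfl
        omega
      intro i j
      fin_cases i <;> fin_cases j <;> simp [hab, hab.symm]
    · rintro ⟨x, hx⟩
      rcases h x hx with h0 | h1
      · exact ⟨0, Subtype.ext (t.ext_cell (ha.1.trans h0.symm) (ha.2.trans hx.symm))⟩
      · exact ⟨1, Subtype.ext (t.ext_cell (hb.1.trans h1.symm) (hb.2.trans hx.symm))⟩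
  rw [← Matrix.det_submatrix_equiv_self (Equiv.ofBijective _ hbij), Matrix.det_fin_two]
  simp [columnMatrix, Matrix.toSquareBlock_def, ha, hb]

theorem det_toSquareBlock_of_one {n : ℕ} {μ : YoungDiagram} (t : Tableau n μ) {c : ℕ}
    (h : ∀ x, t.col x = c → t.row x = 0) :
    ((columnMatrix t).toSquareBlock t.col c).det = 1 := by
  have : Subsingleton {x // t.col x = c} :=
    ⟨fun x y => Subtype.ext (t.ext_cell ((h x x.2).trans (h y y.2).symm) (x.2.trans y.2.symm))⟩
  rcases isEmpty_or_nonempty {x // t.col x = c} with _ | ⟨⟨x⟩⟩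
  · exact Matrix.det_isEmpty
  · rw [Matrix.det_eq_elem_of_subsingleton _ x]
    simp [columnMatrix, Matrix.toSquareBlock_def, h x x.2]

theorem tabloidPoly_polytabloid {n k : ℕ} {h : k ≤ n / 2} (t : Tableau n (twoRow n k h))
    {a b : Fin k → Fin n} (ha : ∀ i, (t (a i)).1 = (0, (i : ℕ)))
    (hb : ∀ i, (t (b i)).1 = (1, (i : ℕ))) :
    tabloidPoly n (polytabloid t) = pairProduct ℂ a b := by
  have hcell : ∀ x, (t.row x = 0 ∧ t.col x < n - k) ∨ (t.row x = 1 ∧ t.col x < k) := fun x =>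
    mem_twoRow.1 (t x).2
  rw [tabloidPoly_polytabloid_eq_det, columnMatrix_det, pairProduct,
    ← Finset.prod_subset (s₁ := Finset.range k), Finset.prod_range]
  · refine Finset.prod_congr rfl fun i _ => ?_
    refine det_toSquareBlock_of_two t ⟨?_, ?_⟩ ⟨?_, ?_⟩ fun x _ => (hcell x).imp And.left And.left
    · simp [Tableau.row, ha]
    · simp [Tableau.col, ha]
    · simp [Tableau.row, hb]
    · simp [Tableau.col, hb]
  · intro c hc
    refine Finset.mem_image.2 ⟨a ⟨c, Finset.mem_range.1 hc⟩, Finset.mem_univ _, ?_⟩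
    simp [Tableau.col, ha]
  · intro c _ hc
    rw [Finset.mem_range] at hc
    refine det_toSquareBlock_of_one t fun x hx => ?_
    rcases hcell x with h | h <;> omega

theorem exists_tableau {n k : ℕ} (h : k ≤ n / 2) {a b : Fin k → Fin n}
    (hab : Function.Injective (Sum.elim a b)) : ∃ t : Tableau n (twoRow n k h),
      (∀ i, (t (a i)).1 = (0, (i : ℕ))) ∧ ∀ i, (t (b i)).1 = (1, (i : ℕ)) := by
  let g : Fin k ⊕ Fin k → ℕ × ℕ := Sum.elim (fun i => (0, (i : ℕ))) fun i => (1, (i : ℕ))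
  let f : Fin n → ℕ × ℕ := Function.extend (Sum.elim a b) g fun _ => (0, 0)
  have hf : ∀ i, f (Sum.elim a b i) = g i := fun i => hab.extend_apply _ _ i
  have hg : Function.Injective g := by
    rintro (i | i) (j | j) <;> simp [g, Fin.ext_iff]
  obtain ⟨t, ht⟩ := Finset.exists_equiv_extend_of_card_eq (t := (twoRow n k h).cells)
    (s := Finset.univ.image (Sum.elim a b)) (f := f) (by rw [Fintype.card_fin, card_twoRow])
    (by
      rw [Finset.image_image, Finset.image_subset_iff]
      intro i _
      rw [Function.comp_apply, hf, mem_twoRow]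
      rcases i with i | i <;> simp [g]
      omega)
    (by
      rw [Finset.coe_image, Finset.coe_univ, Set.image_univ]
      rintro _ ⟨i, rfl⟩ _ ⟨j, rfl⟩ hij
      rw [hf, hf] at hij
      rw [hg hij])
  have ht' : ∀ i, (t (Sum.elim a b i)).1 = g i := fun i =>
    (ht _ (Finset.mem_image_of_mem _ (Finset.mem_univ i))).trans (hf i)
  exact ⟨t, fun i => ht' (Sum.inl i), fun i => ht' (Sum.inr i)⟩

/-- The Specht module of a two-row shape, as a space of polynomials. -/
theorem map_specht {n k : ℕ} (h : k ≤ n / 2) :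
    (specht n (twoRow n k h)).toSubmodule.map (tabloidPoly n).toLinearMap =
      pairProducts ℂ Finset.univ k := by
  rw [specht, Submodule.map_span, pairProducts]
  congr 1
  ext q
  constructor
  · rintro ⟨_, ⟨t, rfl⟩, rfl⟩
    let a : Fin k → Fin n := fun i =>
      t.symm ⟨(0, i), mem_twoRow.2 (Or.inl ⟨rfl, by have := i.2; simp only; omega⟩)⟩
    let b : Fin k → Fin n := fun i => t.symm ⟨(1, i), mem_twoRow.2 (Or.inr ⟨rfl, i.2⟩)⟩
    refine ⟨a, b, ⟨?_, fun _ => Finset.mem_univ _⟩, ?_⟩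
    · rintro (i | i) (j | j) <;> simp [a, b, Fin.ext_iff]
    · exact (tabloidPoly_polytabloid t (fun i => by simp [a]) (fun i => by simp [b])).symm
  · rintro ⟨a, b, hab, rfl⟩
    obtain ⟨t, ha, hb⟩ := exists_tableau h hab.1
    exact ⟨_, ⟨t, rfl⟩, tabloidPoly_polytabloid t ha hb⟩

end Tabloids

/-! ### Characters as differences of permutation characters -/

section Trace

set_option linter.unusedSectionVars false

/-- Additivity of the trace for the kernel of an equivariant map with an equivariant section up to
an automorphism. -/
theorem trace_restrict_add {K V : Type*} [Field K] [AddCommGroup V] [Module K V]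
    {g : V →ₗ[K] V} {P M N : Submodule K V} [FiniteDimensional K M] [FiniteDimensional K P]
    [FiniteDimensional K N] (hP : ∀ v ∈ P, g v ∈ P) (hM : ∀ v ∈ M, g v ∈ M) (hN : ∀ v ∈ N, g v ∈ N)
    (D U : V →ₗ[K] V) (hD : ∀ v ∈ M, D v ∈ N) (hU : ∀ v ∈ N, U v ∈ M)
    (hgU : ∀ v, g (U v) = U (g v)) (hker : ∀ v, v ∈ P ↔ v ∈ M ∧ D v = 0)
    (hinj : ∀ v ∈ N, D (U v) = 0 → v = 0) :
    LinearMap.trace K P (g.restrict hP) + LinearMap.trace K N (g.restrict hN) =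
      LinearMap.trace K M (g.restrict hM) := by
  have hPM : P ≤ M := fun v hv => ((hker v).1 hv).1
  -- The equivariant map `(p, q) ↦ p + Uq` is an isomorphism. It is injective since `D` kills `p`
  -- and `DU` is injective on `N`; it is onto since `DU` is then bijective on the finite-dimensional
  -- `N`, so every `f` has a `q` with `f - Uq` in the kernel of `D`.
  let E : P × N →ₗ[K] M := (Submodule.inclusion hPM).coprod (U.restrict hU)
  have hE : ∀ y : P × N, (E y : V) = y.1 + U y.2 := fun y => by simp [E]
  have hbij : Function.Bijective E := by
    constructor
    · rw [← LinearMap.ker_eq_bot, LinearMap.ker_eq_bot']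
      rintro ⟨p, q⟩ h
      have h1 : (p : V) + U q = 0 := by
        rw [← hE (p, q), h]
        rfl
      have h2 : D (U q) = 0 := by
        have := congrArg D h1
        rwa [map_add, ((hker p).1 p.2).2, zero_add, map_zero] at this
      have hq := hinj q q.2 h2
      rw [hq, map_zero, add_zero] at h1
      exact Prod.ext (Subtype.ext h1) (Subtype.ext hq)
    · intro f
      let DU : N →ₗ[K] N := (D ∘ₗ U).restrict fun v hv => hD _ (hU v hv)
      have hDU : Function.Injective DU := by
        rw [← LinearMap.ker_eq_bot, LinearMap.ker_eq_bot']
        intro q h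
        exact Subtype.ext (hinj q q.2 (congrArg Subtype.val h))
      obtain ⟨q, hq⟩ := LinearMap.surjective_of_injective hDU ⟨D f, hD f f.2⟩
      have hq' : D (U q) = D f := congrArg Subtype.val hq
      refine ⟨(⟨f - U q, (hker _).2 ⟨Submodule.sub_mem _ f.2 (hU q q.2), ?_⟩⟩, q), ?_⟩
      · rw [map_sub, hq', sub_self]
      · exact Subtype.ext (by rw [hE]; simp)
  let e := LinearEquiv.ofBijective E hbij
  rw [← LinearMap.trace_prodMap', ← LinearMap.trace_conj' _ e]
  congr 1
  ext m
  obtain ⟨y, rfl⟩ := e.surjective m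
  rw [LinearEquiv.conj_apply_apply, LinearEquiv.symm_apply_apply]
  change ((E (_, _) : M) : V) = g (E y)
  rw [hE, hE, map_add, hgU]
  rfl

theorem trace_restrict_of_permutes {K V ι : Type*} [Field K] [AddCommGroup V] [Module K V]
    [Fintype ι] [DecidableEq ι] {v : ι → V} (hv : LinearIndependent K v) {p : Submodule K V}
    (hp : Submodule.span K (Set.range v) = p) {g : V →ₗ[K] V} (hg : ∀ x ∈ p, g x ∈ p) (π : ι → ι)
    (hπ : ∀ i, g (v i) = v (π i)) :
    LinearMap.trace K p (g.restrict hg) = (Finset.univ.filter fun i => π i = i).card := by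
  subst hp
  let b := Module.Basis.span hv
  have hb : ∀ i, g.restrict hg (b i) = b (π i) := fun i => Subtype.ext (by
    rw [LinearMap.coe_restrict_apply, Module.Basis.span_apply, Module.Basis.span_apply, hπ])
  rw [LinearMap.trace_eq_matrix_trace K b, Matrix.trace, Finset.card_filter, Nat.cast_sum]
  refine Finset.sum_congr rfl fun i _ => ?_
  rw [Matrix.diag_apply, LinearMap.toMatrix_apply, hb, Module.Basis.repr_self,
    Finsupp.single_apply]
  split_ifs <;> simp

theorem trace_restrict_congr {K V : Type*} [Field K] [AddCommGroup V] [Module K V]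
    {g : V →ₗ[K] V} {p q : Submodule K V} (h : p = q) (hp : ∀ x ∈ p, g x ∈ p)
    (hq : ∀ x ∈ q, g x ∈ q) :
    LinearMap.trace K p (g.restrict hp) = LinearMap.trace K q (g.restrict hq) := by
  subst h
  rfl

theorem trace_restrict_map {K V W : Type*} [Field K] [AddCommGroup V] [Module K V]
    [AddCommGroup W] [Module K W] (e : V ≃ₗ[K] W) {p : Submodule K V} {q : Submodule K W}
    (h : p.map e.toLinearMap = q) {f : V →ₗ[K] V} {g : W →ₗ[K] W} (hp : ∀ x ∈ p, f x ∈ p)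
    (hq : ∀ x ∈ q, g x ∈ q) (hfg : ∀ v, e (f v) = g (e v)) :
    LinearMap.trace K p (f.restrict hp) = LinearMap.trace K q (g.restrict hq) := by
  subst h
  rw [← LinearMap.trace_conj' _ (e.submoduleMap p)]
  congr 1
  ext y : 2
  obtain ⟨v, rfl⟩ := (e.submoduleMap p).surjective y
  rw [LinearEquiv.conj_apply_apply, LinearEquiv.symm_apply_apply]
  exact hfg v

open MvPolynomial

variable {ι K : Type*} [DecidableEq ι] [Field K]

theorem rename_sqfreeMonomial (σ : Equiv.Perm ι) (T : Finset ι) :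
    rename σ (sqfreeMonomial K T) = sqfreeMonomial K (T.map σ.toEmbedding) := by
  simp [sqfreeMonomial]

theorem sqfreeMonomial_linearIndependent :
    LinearIndependent K (sqfreeMonomial K : Finset ι → MvPolynomial ι K) := by
  have h : (sqfreeMonomial K : Finset ι → MvPolynomial ι K) =
      basisMonomials ι K ∘ fun T => ∑ a ∈ T, Finsupp.single a 1 := by
    ext1 T
    rw [Function.comp_apply, coe_basisMonomials]
    dsimp only
    rw [monomial_sum_one]
    rfl
  rw [h]
  refine (basisMonomials ι K).linearIndependent.comp _ fun S T hST => ?_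
  ext a
  have := congrArg (fun s : ι →₀ ℕ => s a) hST
  simp only [Finsupp.finsetSum_apply, Finsupp.single_apply, Finset.sum_ite_eq'] at this
  split_ifs at this <;> simp_all

variable [Fintype ι]

theorem rename_raising (σ : Equiv.Perm ι) (f : MvPolynomial ι K) :
    rename σ (raising Finset.univ f) = raising Finset.univ (rename σ f) := by
  rw [raising_apply, raising_apply, map_sum]
  refine Fintype.sum_equiv σ _ _ fun a => ?_
  rw [map_sub, map_mul, map_mul, map_pow, rename_X, pderiv_rename σ.injective]

theorem rename_mem_multilinearForms (σ : Equiv.Perm ι) {k : ℕ} (f : MvPolynomial ι K)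
    (hf : f ∈ multilinearForms K Finset.univ k) :
    (rename σ).toLinearMap f ∈ multilinearForms K Finset.univ k :=
  map_mem_of_sqfreeMonomial (rename σ).toLinearMap _ (fun T _ hk => by
    rw [AlgHom.toLinearMap_apply, rename_sqfreeMonomial]
    exact sqfreeMonomial_mem (Finset.subset_univ _) (by rw [Finset.card_map, hk])) hf

/-- The sets fixed by `σ`. -/
def fixedSets (σ : Equiv.Perm ι) : Finset (Finset ι) :=
  Finset.univ.filter fun T => T.map σ.toEmbedding = T

/-- The generating polynomial of the sets fixed by `σ`, by cardinality. -/
noncomputable def fixedSetsPoly (σ : Equiv.Perm ι) : Polynomial ℤ :=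
  ∑ T ∈ fixedSets σ, Polynomial.X ^ T.card

theorem coeff_fixedSetsPoly (σ : Equiv.Perm ι) (k : ℕ) :
    (fixedSetsPoly σ).coeff k = ((fixedSets σ).filter fun T => T.card = k).card := by
  rw [fixedSetsPoly, Polynomial.finsetSum_coeff, Finset.card_filter, Nat.cast_sum]
  refine Finset.sum_congr rfl fun T _ => ?_
  rw [Polynomial.coeff_X_pow]
  split_ifs <;> simp_all

instance (A : Finset ι) (k : ℕ) : FiniteDimensional K (multilinearForms K A k) :=
  FiniteDimensional.span_of_finite K (Set.toFinite _)

theorem trace_multilinearForms (σ : Equiv.Perm ι) (k : ℕ) :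
    LinearMap.trace K (multilinearForms K Finset.univ k)
      ((rename σ).toLinearMap.restrict (rename_mem_multilinearForms σ)) =
      ((fixedSetsPoly σ).coeff k : ℤ) := by
  have hspan : Submodule.span K (Set.range fun T : {T : Finset ι // T.card = k} =>
      sqfreeMonomial K T.1) = multilinearForms K Finset.univ k := by
    rw [multilinearForms, Set.image_eq_range]
    congr 1
    ext f
    simp
  rw [trace_restrict_of_permutes
    (sqfreeMonomial_linearIndependent.comp _ Subtype.val_injective) hspan _
    (fun T => ⟨T.1.map σ.toEmbedding, by rw [Finset.card_map, T.2]⟩)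
    (fun T => rename_sqfreeMonomial σ T.1), coeff_fixedSetsPoly, Int.cast_natCast]
  congr 1
  refine Finset.card_bij (fun T _ => T.1) ?_ (fun _ _ _ _ h => Subtype.ext h) ?_
  · intro T hT
    simpa [fixedSets, T.2, Subtype.ext_iff] using hT
  · intro T hT
    rw [Finset.mem_filter] at hT
    exact ⟨⟨T, hT.2⟩, by simpa [fixedSets, Subtype.ext_iff] using hT.1, rfl⟩

/-- The Specht module is the kernel of `D` from degree `k` to degree `k - 1`, with `U` as
equivariant section up to an automorphism, so its trace is a difference of two permutation traces.
In degree `0` it is the whole space of forms. -/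
theorem spechtChar_twoRow {n k : ℕ} (h : k ≤ n / 2) (σ : Equiv.Perm (Fin n)) :
    spechtChar n (twoRow n k h) σ =
      (((1 - Polynomial.X) * fixedSetsPoly σ).coeff k : ℤ) := by
  have hmem : ∀ f, f ∈ pairProducts ℂ (Finset.univ : Finset (Fin n)) k ↔
      f ∈ multilinearForms ℂ Finset.univ k ∧ lowering (Fin n) ℂ f = 0 := fun f =>
    ⟨fun hf => ⟨pairProducts_le _ _ hf, lowering_eq_zero_of_mem_pairProducts hf⟩,
      fun hf => mem_pairProducts _ (by rw [Finset.card_univ, Fintype.card_fin]; omega) hf.1 hf.2⟩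
  have hinv : ∀ f ∈ pairProducts ℂ (Finset.univ : Finset (Fin n)) k,
      (rename σ).toLinearMap f ∈ pairProducts ℂ (Finset.univ : Finset (Fin n)) k := by
    rw [← map_specht h]
    rintro _ ⟨v, hv, rfl⟩
    exact ⟨_, (specht n (twoRow n k h)).apply_mem_toSubmodule σ hv,
      tabloidPoly_tabloidRep σ v⟩
  have : FiniteDimensional ℂ (pairProducts ℂ (Finset.univ : Finset (Fin n)) k) :=
    Submodule.finiteDimensional_of_le (pairProducts_le _ _)
  have hconj : spechtChar n (twoRow n k h) σ =
      LinearMap.trace ℂ _ ((rename σ).toLinearMap.restrict hinv) :=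
    trace_restrict_map (tabloidPoly n) (map_specht h)
      ((specht n (twoRow n k h)).apply_mem_toSubmodule σ) hinv (tabloidPoly_tabloidRep σ)
  rw [hconj, sub_mul, one_mul, Polynomial.coeff_sub, Int.cast_sub, ← trace_multilinearForms,
    eq_sub_iff_add_eq]
  cases k with
  | zero =>
    rw [Polynomial.coeff_X_mul_zero, Int.cast_zero, add_zero]
    have heq : pairProducts ℂ (Finset.univ : Finset (Fin n)) 0 =
        multilinearForms ℂ Finset.univ 0 :=
      le_antisymm (pairProducts_le _ _) (multilinearForms_zero_le _)
    exact trace_restrict_congr heq _ _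
  | succ k =>
    rw [Polynomial.coeff_X_mul, ← trace_multilinearForms]
    refine trace_restrict_add hinv _ _ (lowering (Fin n) ℂ).toLinearMap (raising Finset.univ)
      (fun v hv => lowering_mem hv) (fun v hv => raising_mem hv) (rename_raising σ) hmem
      fun v hv => eq_zero_of_lowering_raising_eq_zero ?_ hv
    rw [Finset.card_univ, Fintype.card_fin]
    omega

end Trace

/-! ### Sets fixed by an involution and the generating function of `α` -/

section Involutions

open Polynomial

/-- `S` is a union of pairs `{2 * a, 2 * a + 1}` below `2 * j`. -/
def IsPaired (j : ℕ) (S : Finset ℕ) : Prop := ∀ a < j, 2 * a ∈ S ↔ 2 * a + 1 ∈ S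

open Classical in
/-- The generating polynomial of the paired subsets of `{0, …, n-1}`, by cardinality. -/
noncomputable def pairedPoly (n j : ℕ) : ℤ[X] :=
  ∑ S ∈ (Finset.range n).powerset, if IsPaired j S then X ^ S.card else 0

theorem isPaired_insert {j m : ℕ} (hm : 2 * j ≤ m) (S : Finset ℕ) :
    IsPaired j (insert m S) ↔ IsPaired j S := by
  refine forall₂_congr fun a ha => ?_
  rw [Finset.mem_insert, Finset.mem_insert, or_iff_right (by omega), or_iff_right (by omega)]

theorem pairedPoly_succ {n j : ℕ} (h : 2 * j ≤ n) :
    pairedPoly (n + 1) j = pairedPoly n j * (1 + X) := by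
  rw [pairedPoly, Finset.range_add_one, Finset.sum_powerset_insert Finset.notMem_range_self,
    mul_add, mul_one, pairedPoly, Finset.sum_mul]
  congr 1
  refine Finset.sum_congr rfl fun S hS => ?_
  have hn : n ∉ S := fun hn => by simpa using Finset.mem_powerset.1 hS hn
  rw [isPaired_insert h, Finset.card_insert_of_notMem hn, pow_succ, ite_mul, zero_mul]

theorem isPaired_succ {j : ℕ} {S : Finset ℕ} :
    IsPaired (j + 1) S ↔ IsPaired j S ∧ (2 * j ∈ S ↔ 2 * j + 1 ∈ S) := by
  simp only [IsPaired, Nat.lt_succ_iff_lt_or_eq]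
  constructor
  · exact fun h => ⟨fun a ha => h a (Or.inl ha), h j (Or.inr rfl)⟩
  · rintro ⟨h1, h2⟩ a (ha | rfl)
    · exact h1 a ha
    · exact h2

/-- Of the four ways to extend a set by `2j` and `2j + 1`, only taking neither or both stays paired.
-/
theorem pairedPoly_succ_succ (j : ℕ) :
    pairedPoly (2 * (j + 1)) (j + 1) = pairedPoly (2 * j) j * (1 + X ^ 2) := by
  have hj : 2 * j ∉ Finset.range (2 * j) := Finset.notMem_range_self
  have hj' : 2 * j + 1 ∉ insert (2 * j) (Finset.range (2 * j)) := by simp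
  rw [pairedPoly, mul_add, mul_one, Finset.range_add_one, Finset.range_add_one,
    Finset.sum_powerset_insert hj', Finset.sum_powerset_insert hj, Finset.sum_powerset_insert hj,
    pairedPoly, Finset.sum_mul, ← Finset.sum_add_distrib, ← Finset.sum_add_distrib,
    ← Finset.sum_add_distrib]
  refine Finset.sum_congr rfl fun S hS => ?_
  have h0 : 2 * j ∉ S := fun h => by simpa using Finset.mem_powerset.1 hS h
  have h1 : 2 * j + 1 ∉ S := fun h => by simpa using Finset.mem_powerset.1 hS h
  have h2 : 2 * j + 1 ∉ insert (2 * j) S := by simp [h1]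
  have e0 : IsPaired (j + 1) S ↔ IsPaired j S := by simp [isPaired_succ, h0, h1]
  have e1 : ¬ IsPaired (j + 1) (insert (2 * j) S) := by simp [isPaired_succ, h1]
  have e2 : ¬ IsPaired (j + 1) (insert (2 * j + 1) S) := by simp [isPaired_succ, h0]
  have e3 : IsPaired (j + 1) (insert (2 * j + 1) (insert (2 * j) S)) ↔ IsPaired j S := by
    rw [isPaired_succ, isPaired_insert (Nat.le_succ _), isPaired_insert le_rfl]
    simp
  rw [Finset.card_insert_of_notMem h2, Finset.card_insert_of_notMem h0]
  by_cases hS' : IsPaired j S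
  · rw [if_pos (e0.2 hS'), if_neg e1, if_neg e2, if_pos (e3.2 hS'), if_pos hS']
    ring
  · rw [if_neg fun h => hS' (e0.1 h), if_neg e1, if_neg e2, if_neg fun h => hS' (e3.1 h),
      if_neg hS']
    ring

theorem pairedPoly_eq {n j : ℕ} (h : 2 * j ≤ n) :
    pairedPoly n j = (1 + X ^ 2) ^ j * (1 + X) ^ (n - 2 * j) := by
  obtain ⟨m, rfl⟩ := Nat.exists_eq_add_of_le h
  rw [Nat.add_sub_cancel_left]
  clear h
  induction m with
  | zero =>
    induction j with
    | zero => simp [pairedPoly, IsPaired]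
    | succ j ih => rw [add_zero, pairedPoly_succ_succ, ← add_zero (2 * j), ih]; ring
  | succ m ih => rw [← add_assoc, pairedPoly_succ (by omega), ih]; ring

/-- Passing to subsets of `ℕ` lets the generating polynomial be computed by adjoining elements one
or two at a time. -/
theorem mem_fixedSets_invol {n j : ℕ} (h : 2 * j ≤ n) (T : Finset (Fin n)) :
    T ∈ fixedSets (invol n j) ↔ IsPaired j (T.map Fin.valEmbedding) := by
  have hmem : ∀ (m : ℕ) (hm : m < n), m ∈ T.map Fin.valEmbedding ↔ (⟨m, hm⟩ : Fin n) ∈ T := by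
    intro m hm
    rw [Finset.mem_map]
    exact ⟨fun ⟨x, hx, hxm⟩ => by subst hxm; exact hx, fun hx => ⟨_, hx, rfl⟩⟩
  have hfix : T ∈ fixedSets (invol n j) ↔ ∀ x, involFun n j x ∈ T ↔ x ∈ T := by
    rw [fixedSets, Finset.mem_filter, Finset.ext_iff]
    simp only [Finset.mem_univ, true_and, Finset.mem_map_equiv]
    rfl
  rw [hfix]
  constructor
  · intro hT a ha
    rw [hmem _ (by omega), hmem _ (by omega), ← hT ⟨2 * a, by omega⟩]
    have : involFun n j ⟨2 * a, by omega⟩ = ⟨2 * a + 1, by omega⟩ := by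
      simp only [involFun]
      rw [dif_pos ⟨h, by omega⟩, dif_pos (by omega)]
    rw [this]
  · rintro hT ⟨x, hx⟩
    by_cases hxj : x < 2 * j
    · have hT' := hT (x / 2) (by omega)
      rw [hmem _ (by omega), hmem _ (by omega)] at hT'
      by_cases hx2 : x % 2 = 0
      · have : involFun n j ⟨x, hx⟩ = ⟨2 * (x / 2) + 1, by omega⟩ := by
          simp only [involFun]
          rw [dif_pos ⟨h, hxj⟩, dif_pos hx2, Fin.mk.injEq]
          omega
        rw [this, ← hT']
        simp only [show 2 * (x / 2) = x by omega]
      · have : involFun n j ⟨x, hx⟩ = ⟨2 * (x / 2), by omega⟩ := by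
          simp only [involFun]
          rw [dif_pos ⟨h, hxj⟩, dif_neg hx2, Fin.mk.injEq]
          omega
        rw [this, hT']
        simp only [show 2 * (x / 2) + 1 = x by omega]
    · rw [involFun, dif_neg (fun h' => hxj h'.2)]

theorem fixedSetsPoly_invol {n j : ℕ} (h : 2 * j ≤ n) :
    fixedSetsPoly (invol n j) = (1 + X ^ 2) ^ j * (1 + X) ^ (n - 2 * j) := by
  classical
  rw [← pairedPoly_eq h, fixedSetsPoly, pairedPoly, ← Finset.sum_filter]
  refine Finset.sum_bij (fun T _ => T.map Fin.valEmbedding) ?_ ?_ ?_ ?_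
  · intro T hT
    rw [Finset.mem_filter, Finset.mem_powerset]
    refine ⟨fun m hm => ?_, (mem_fixedSets_invol h T).1 hT⟩
    obtain ⟨x, -, rfl⟩ := Finset.mem_map.1 hm
    exact Finset.mem_range.2 x.2
  · intro S _ T _ hST
    exact Finset.map_injective _ hST
  · intro S hS
    rw [Finset.mem_filter, Finset.mem_powerset] at hS
    have hn : ∀ m ∈ S, m < n := fun m hm => Finset.mem_range.1 (hS.1 hm)
    refine ⟨S.attachFin hn, ?_, Finset.map_valEmbedding_attachFin hn⟩
    rw [mem_fixedSets_invol h, Finset.map_valEmbedding_attachFin hn]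
    exact hS.2
  · intro T _
    rw [Finset.card_map]

theorem alpha_eq_coeff {n k i : ℕ} (hk : k ≤ n / 2) (hi : i ≤ n / 2) :
    alpha n k i =
      (((1 - X) * (1 + X) ^ (n - 2 * i) * (1 + X + X ^ 2) ^ i : ℤ[X]).coeff k : ℤ) := by
  rw [alpha, dif_pos ⟨hk, hi⟩, alphaShape, div_eq_iff (pow_ne_zero _ two_ne_zero)]
  have hpoly : ∑ j ∈ Finset.range (i + 1),
      C (i.choose j : ℤ) * ((1 - X) * ((1 + X ^ 2) ^ j * (1 + X) ^ (n - 2 * j))) =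
      C (2 ^ i : ℤ) * ((1 - X) * (1 + X) ^ (n - 2 * i) * (1 + X + X ^ 2) ^ i) := by
    -- This identity absorbs the factor `2 ^ i` in the definition of `α`; the right side expands
    -- into the binomial sum over `j`.
    have h1 : (C (2 ^ i : ℤ) : ℤ[X]) * (1 + X + X ^ 2) ^ i = ((1 + X ^ 2) + (1 + X) ^ 2) ^ i := by
      rw [C_pow, ← mul_pow]
      congr 1
      rw [show (C (2 : ℤ) : ℤ[X]) = 2 from rfl]
      ring
    rw [mul_left_comm, h1, add_pow (1 + X ^ 2 : ℤ[X]), Finset.mul_sum]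
    refine Finset.sum_congr rfl fun j hj => ?_
    rw [Finset.mem_range] at hj
    rw [show n - 2 * j = n - 2 * i + 2 * (i - j) by omega, pow_add, pow_mul]
    simp only [map_natCast]
    ring
  have hc := congrArg (fun p : ℤ[X] => ((p.coeff k : ℤ) : ℂ)) hpoly
  simp only [finsetSum_coeff, coeff_C_mul] at hc
  push_cast at hc
  rw [mul_comm _ ((2 : ℂ) ^ i), ← hc]
  refine Finset.sum_congr rfl fun j hj => ?_
  rw [Finset.mem_range] at hj
  rw [spechtChar_twoRow, fixedSetsPoly_invol (by omega)]

end Involutions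

/-! ### Counting paths with restricted peaks -/

section Paths

open Polynomial

theorem height_snoc {n : ℕ} (Q : Fin n → Step) (a : Step) (x : ℕ) :
    height (Fin.snoc Q a : Fin (n + 1) → Step) x = height Q x + if n < x then a.rise else 0 := by
  simp only [height, Finset.sum_filter, Fin.sum_univ_castSucc, Fin.snoc_castSucc, Fin.snoc_last,
    Fin.val_castSucc, Fin.val_last]

theorem height_succ {n : ℕ} (Q : Fin n → Step) : height Q (n + 1) = height Q n := by
  simp only [height, Finset.sum_filter]
  refine Finset.sum_congr rfl fun s _ => ?_
  rw [if_pos (by omega), if_pos (by omega)]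

theorem exists_eq_snoc {n : ℕ} (P : Fin (n + 1) → Step) :
    ∃ (Q : Fin n → Step) (a : Step), P = (Fin.snoc Q a : Fin (n + 1) → Step) :=
  ⟨Fin.init P, P (Fin.last n), (Fin.snoc_init_self P).symm⟩

theorem odd_height_iff {n : ℕ} (P : Fin n → Step) {x : ℕ} (hx : x ≤ n) :
    Odd (height P x) ↔ Odd x := by
  induction n generalizing x with
  | zero =>
    obtain rfl : x = 0 := by omega
    simp [height]
  | succ n ih =>
    obtain ⟨Q, a, rfl⟩ := exists_eq_snoc P
    rw [height_snoc]
    rcases Nat.le_succ_iff.1 hx with h | rfl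
    · rw [if_neg (by omega), add_zero, ih Q h]
    · have h := ih Q le_rfl
      rw [if_pos (by omega), height_succ]
      cases a <;> simp only [Step.rise, Int.odd_iff, Nat.odd_iff] at h ⊢ <;> omega

theorem height_eq {n : ℕ} (P : Fin n → Step) :
    height P n = (stepCount P Step.U : ℤ) - stepCount P Step.D := by
  simp only [height, stepCount, Finset.card_filter, Finset.sum_filter]
  push_cast
  rw [← Finset.sum_sub_distrib]
  refine Finset.sum_congr rfl fun s _ => ?_
  rw [if_pos s.2]
  cases P s <;> simp [Step.rise]

theorem stepCount_add {n : ℕ} (P : Fin n → Step) :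
    stepCount P Step.U + stepCount P Step.D = n := by
  simp only [stepCount, Finset.card_filter]
  rw [← Finset.sum_add_distrib, Finset.sum_congr rfl (g := fun _ => 1), Finset.sum_const]
  · simp
  · intro s _
    cases P s <;> simp

theorem isNonneg_snoc {n : ℕ} (Q : Fin n → Step) (a : Step) :
    IsNonneg (Fin.snoc Q a : Fin (n + 1) → Step) ↔ IsNonneg Q ∧ 0 ≤ height Q n + a.rise := by
  simp only [IsNonneg, height_snoc]
  constructor
  · intro h
    refine ⟨fun x hx => ?_, ?_⟩
    · have := h x (by omega)
      rwa [if_neg (by omega), add_zero] at this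
    · have := h (n + 1) le_rfl
      rwa [if_pos (by omega), height_succ] at this
  · rintro ⟨h1, h2⟩ x hx
    rcases Nat.le_succ_iff.1 hx with h | rfl
    · rw [if_neg (by omega), add_zero]
      exact h1 x h
    · rwa [if_pos (by omega), height_succ]

/-- The path ends with an Up step. -/
def EndsUp {n : ℕ} (P : Fin n → Step) : Prop := ∃ s : Fin n, (s : ℕ) + 1 = n ∧ P s = Step.U

theorem endsUp_snoc {n : ℕ} (Q : Fin n → Step) (a : Step) :
    EndsUp (Fin.snoc Q a : Fin (n + 1) → Step) ↔ a = Step.U := by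
  constructor
  · rintro ⟨s, hs, h⟩
    obtain rfl : s = Fin.last n := Fin.ext (by simp; omega)
    simpa using h
  · rintro rfl
    exact ⟨Fin.last n, by simp, by simp⟩

theorem isPeak_snoc {n : ℕ} (Q : Fin n → Step) (a : Step) (x : ℕ) :
    IsPeak (Fin.snoc Q a : Fin (n + 1) → Step) x ↔
      IsPeak Q x ∨ (x = n ∧ a = Step.D ∧ EndsUp Q) := by
  constructor
  · rintro ⟨s, t, hs, ht, hU, hD⟩
    obtain ⟨s, rfl⟩ : ∃ s', s = Fin.castSucc s' := ⟨⟨s, by omega⟩, rfl⟩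
    rw [Fin.snoc_castSucc] at hU
    rw [Fin.val_castSucc] at hs
    rcases Fin.eq_castSucc_or_eq_last t with ⟨t, rfl⟩ | rfl
    · rw [Fin.snoc_castSucc] at hD
      exact Or.inl ⟨s, t, hs, ht, hU, hD⟩
    · rw [Fin.snoc_last] at hD
      rw [Fin.val_last] at ht
      exact Or.inr ⟨ht.symm, hD, s, hs.trans ht.symm, hU⟩
  · rintro (⟨s, t, hs, ht, hU, hD⟩ | ⟨rfl, rfl, s, hs, hU⟩)
    · exact ⟨s.castSucc, t.castSucc, hs, ht, by rwa [Fin.snoc_castSucc], by rwa [Fin.snoc_castSucc]⟩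
    · exact ⟨s.castSucc, Fin.last _, hs, rfl, by rwa [Fin.snoc_castSucc], by rw [Fin.snoc_last]⟩

theorem IsPeak.lt {n : ℕ} {P : Fin n → Step} {x : ℕ} (h : IsPeak P x) : x < n := by
  obtain ⟨_, t, _, ht, _⟩ := h
  exact ht ▸ t.2

/-- Odd height means odd abscissa, and an odd `x = 2d + 1` lies in exactly one interval, the one
with index `d + 1`. -/
theorem oddPeaksIn_iff {n : ℕ} {P : Fin n → Step} {m : ℕ} :
    OddPeaksIn P m ↔ ∀ x, IsPeak P x → Odd x → x < 2 * m := by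
  refine forall₂_congr fun x hx => ?_
  rw [odd_height_iff P hx.lt.le]
  refine forall_congr' fun hodd => ?_
  obtain ⟨d, rfl⟩ := hodd
  constructor
  · rintro ⟨e, he, h1, h2⟩
    rw [Finset.mem_Icc] at he
    omega
  · intro h
    exact ⟨d + 1, Finset.mem_Icc.2 ⟨by omega, by omega⟩, by omega, by omega⟩

theorem oddPeaksIn_snoc {n m : ℕ} (Q : Fin n → Step) (a : Step) :
    OddPeaksIn (Fin.snoc Q a : Fin (n + 1) → Step) m ↔
      OddPeaksIn Q m ∧ (a = Step.D → EndsUp Q → Odd n → n < 2 * m) := by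
  simp only [oddPeaksIn_iff, isPeak_snoc]
  constructor
  · exact fun h => ⟨fun x hx => h x (Or.inl hx), fun ha hQ => h n (Or.inr ⟨rfl, ha, hQ⟩)⟩
  · rintro ⟨h1, h2⟩ x (hx | ⟨rfl, ha, hQ⟩)
    · exact h1 x hx
    · exact h2 ha hQ

/-- The nonnegative paths with `n` steps that end at height `h` and whose odd-height peaks lie in
the first `m` intervals. -/
def pathsTo (n m : ℕ) (h : ℤ) : Set (Fin n → Step) :=
  {P | height P n = h ∧ IsNonneg P ∧ OddPeaksIn P m}

theorem restrictedPaths_eq (n k m : ℕ) : restrictedPaths n k m = pathsTo n m (n - 2 * k) := by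
  ext P
  have h1 := height_eq P
  have h2 := stepCount_add P
  simp only [restrictedPaths, pathsTo, Set.mem_ofPred_eq]
  constructor
  · rintro ⟨h, -, -, hP⟩
    exact ⟨h, hP⟩
  · rintro ⟨h, hP⟩
    exact ⟨h, by omega, by omega, hP⟩

theorem snoc_mem_pathsTo {n m : ℕ} {h : ℤ} (hh : 0 ≤ h) (Q : Fin n → Step) (a : Step) :
    (Fin.snoc Q a : Fin (n + 1) → Step) ∈ pathsTo (n + 1) m h ↔
      Q ∈ pathsTo n m (h - a.rise) ∧ (a = Step.D → EndsUp Q → Odd n → n < 2 * m) := by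
  simp only [pathsTo, Set.mem_ofPred_eq, height_snoc, height_succ, isNonneg_snoc, oddPeaksIn_snoc]
  rw [if_pos (Nat.lt_succ_self n), eq_sub_iff_add_eq]
  constructor
  · rintro ⟨h1, ⟨h2, -⟩, h3, h4⟩
    exact ⟨⟨h1, h2, h3⟩, h4⟩
  · rintro ⟨⟨h1, h2, h3⟩, h4⟩
    exact ⟨h1, ⟨h2, by omega⟩, h3, h4⟩

theorem snoc_left_injective {n : ℕ} (a : Step) :
    Function.Injective fun Q : Fin n → Step => (Fin.snoc Q a : Fin (n + 1) → Step) :=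
  fun _ _ h => (Fin.snoc_injective2 h).1

/-- Paths are split by their last step. Only a final Down can create a peak, at abscissa `n`, and
only after an Up step. -/
theorem ncard_pathsTo_succ {n m : ℕ} {h : ℤ} (hh : 0 ≤ h) :
    (pathsTo (n + 1) m h).ncard = (pathsTo n m (h - 1)).ncard +
      (pathsTo n m (h + 1) ∩ {Q | EndsUp Q → Odd n → n < 2 * m}).ncard := by
  have : pathsTo (n + 1) m h =
      (fun Q => (Fin.snoc Q Step.U : Fin (n + 1) → Step)) '' pathsTo n m (h - 1) ∪
      (fun Q => (Fin.snoc Q Step.D : Fin (n + 1) → Step)) ''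
        (pathsTo n m (h + 1) ∩ {Q | EndsUp Q → Odd n → n < 2 * m}) := by
    ext P
    obtain ⟨Q, a, rfl⟩ := exists_eq_snoc P
    rw [snoc_mem_pathsTo hh]
    simp only [Set.mem_union, Set.mem_image, Set.mem_inter_iff, Set.mem_ofPred_eq]
    have hinj : ∀ (R : Fin n → Step) (b : Step), (Fin.snoc R b : Fin (n + 1) → Step) =
        (Fin.snoc Q a : Fin (n + 1) → Step) ↔ R = Q ∧ b = a := fun R b =>
      Fin.snoc_inj
    simp only [hinj]
    cases a <;> simp [Step.rise]
  rw [this, Set.ncard_union_eq ?_ (Set.toFinite _) (Set.toFinite _),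
    Set.ncard_image_of_injective _ (snoc_left_injective _),
    Set.ncard_image_of_injective _ (snoc_left_injective _)]
  rw [Set.disjoint_left]
  rintro _ ⟨Q, -, rfl⟩ ⟨R, -, hR⟩
  exact absurd (Fin.snoc_injective2 hR).2 (by simp)

theorem ncard_pathsTo_succ_of_imp {n m : ℕ} (hn : Odd n → n < 2 * m) {h : ℤ} (hh : 0 ≤ h) :
    (pathsTo (n + 1) m h).ncard =
      (pathsTo n m (h - 1)).ncard + (pathsTo n m (h + 1)).ncard := by
  have h1 : pathsTo n m (h + 1) ∩ {Q | EndsUp Q → Odd n → n < 2 * m} = pathsTo n m (h + 1) :=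
    Set.inter_eq_left.2 fun _ _ _ => hn
  rw [ncard_pathsTo_succ hh, h1]

/-- Past the allowed intervals, the paths to height `h + 1` that cannot be continued by Down are
those ending with Up. Deleting that Up step matches them with the paths of length `n` to height `h`.
-/
theorem ncard_pathsTo_succ_succ {n m : ℕ} (hn : Even n) (hm : 2 * m ≤ n) {h : ℤ} (hh : 0 ≤ h) :
    (pathsTo (n + 2) m h).ncard + (pathsTo n m h).ncard =
      (pathsTo (n + 1) m (h - 1)).ncard + (pathsTo (n + 1) m (h + 1)).ncard := by
  have hodd : Odd (n + 1) := hn.add_one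
  rw [ncard_pathsTo_succ hh, add_assoc, ← Set.ncard_inter_add_ncard_sdiff_eq_ncard
    (pathsTo (n + 1) m (h + 1)) {Q | EndsUp Q → Odd (n + 1) → n + 1 < 2 * m} (Set.toFinite _)]
  congr 2
  rw [← Set.ncard_image_of_injective _ (snoc_left_injective Step.U)]
  congr 1
  ext P
  obtain ⟨Q, a, rfl⟩ := exists_eq_snoc P
  have hinj : ∀ (R : Fin n → Step) (b : Step), (Fin.snoc R b : Fin (n + 1) → Step) =
      (Fin.snoc Q a : Fin (n + 1) → Step) ↔ R = Q ∧ b = a := fun R b => Fin.snoc_inj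
  have hlt : ¬ n + 1 < 2 * m := by omega
  simp only [Set.mem_sdiff, Set.mem_ofPred_eq, Set.mem_image, hinj, snoc_mem_pathsTo
    (show (0 : ℤ) ≤ h + 1 by omega), endsUp_snoc, hodd, hlt]
  cases a <;> simp [Step.rise]

theorem pathsTo_of_neg {n m : ℕ} {h : ℤ} (hh : h < 0) : pathsTo n m h = ∅ := by
  rw [Set.eq_empty_iff_forall_notMem]
  rintro P ⟨rfl, hP, -⟩
  exact absurd (hP n le_rfl) (by omega)

theorem pathsTo_of_gt {n m : ℕ} {h : ℤ} (hh : n < h) : pathsTo n m h = ∅ := by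
  rw [Set.eq_empty_iff_forall_notMem]
  rintro P ⟨hP, -⟩
  have h1 := height_eq P
  have h2 := stepCount_add P
  omega

theorem pathsTo_zero (m : ℕ) : pathsTo 0 m 0 = Set.univ := by
  rw [Set.eq_univ_iff_forall]
  intro P
  refine ⟨by simp [height], fun x _ => by simp [height], ?_⟩
  rintro x ⟨s, -⟩
  exact s.elim0

/-- `q` is palindromic of formal degree `N`. -/
def IsPalindromic (N : ℕ) (q : ℤ[X]) : Prop := q.natDegree ≤ N ∧ q.reflect N = q

theorem IsPalindromic.mul {M N : ℕ} {p q : ℤ[X]} (hp : IsPalindromic M p)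
    (hq : IsPalindromic N q) : IsPalindromic (M + N) (p * q) :=
  ⟨natDegree_mul_le_of_le hp.1 hq.1, by rw [reflect_mul _ _ hp.1 hq.1, hp.2, hq.2]⟩

theorem IsPalindromic.pow {N : ℕ} {q : ℤ[X]} (hq : IsPalindromic N q) (r : ℕ) :
    IsPalindromic (N * r) (q ^ r) := by
  induction r with
  | zero => exact ⟨by simp, by simp⟩
  | succ r ih => rw [pow_succ, Nat.mul_succ]; exact ih.mul hq

theorem isPalindromic_linear : IsPalindromic 1 (1 + X) := by
  refine ⟨by compute_degree, ?_⟩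
  ext r
  rw [coeff_reflect]
  match r with
  | 0 => simp [coeff_one, coeff_X]
  | 1 => simp [coeff_one, coeff_X]
  | r + 2 => rw [revAt_eq_self_of_lt (by omega)]

theorem isPalindromic_quadratic : IsPalindromic 2 (1 + X + X ^ 2) := by
  refine ⟨by compute_degree, ?_⟩
  ext r
  rw [coeff_reflect]
  match r with
  | 0 => simp [coeff_one, coeff_X]
  | 1 => simp [coeff_one, coeff_X]
  | 2 => simp [coeff_one, coeff_X]
  | r + 3 => rw [revAt_eq_self_of_lt (by omega)]

/-- The coefficients of `q` at `r` and `r + 1` are exchanged by the symmetry, so they cancel. -/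
theorem coeff_one_sub_X_mul_eq_zero {r : ℕ} {q : ℤ[X]} (hq : IsPalindromic (2 * r + 1) q) :
    ((1 - X) * q).coeff (r + 1) = 0 := by
  have h : q.coeff r = q.coeff (r + 1) := by
    conv_lhs => rw [← hq.2]
    rw [coeff_reflect, revAt_le (by omega)]
    congr 1
    omega
  rw [sub_mul, one_mul, coeff_sub, coeff_X_mul, h, sub_self]

/-- The polynomial whose coefficients count the paths with `2 * p` steps. -/
noncomputable def pathPoly (m p : ℕ) : ℤ[X] :=
  (1 - X) * ((1 + X) ^ (2 * min p m) * (1 + X + X ^ 2) ^ (p - m))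

theorem pathPoly_succ_of_lt {m p : ℕ} (h : p < m) :
    pathPoly m (p + 1) = pathPoly m p * (1 + X) * (1 + X) := by
  rw [pathPoly, pathPoly, min_eq_left h.le, min_eq_left h, Nat.sub_eq_zero_of_le h.le,
    Nat.sub_eq_zero_of_le h]
  ring

theorem pathPoly_succ_of_le {m p : ℕ} (h : m ≤ p) :
    pathPoly m (p + 1) + X * pathPoly m p = pathPoly m p * (1 + X) * (1 + X) := by
  rw [pathPoly, pathPoly, min_eq_right h, min_eq_right (by omega), Nat.succ_sub h,
    pow_succ]
  ring

/-- After `2p + 1` steps, `p + 1` Down steps lead to height `-1`. This vanishing lets the polynomial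
recursion respect the axis. -/
theorem coeff_pathPoly_mul_eq_zero (m p : ℕ) : (pathPoly m p * (1 + X)).coeff (p + 1) = 0 := by
  have h := ((isPalindromic_linear.pow (2 * min p m)).mul
    (isPalindromic_quadratic.pow (p - m))).mul isPalindromic_linear
  rw [show 1 * (2 * min p m) + 2 * (p - m) + 1 = 2 * p + 1 by omega] at h
  rw [pathPoly, mul_assoc]
  exact coeff_one_sub_X_mul_eq_zero h

theorem ncard_pathsTo_odd {m p : ℕ}
    (hp : ∀ k ≤ p, ((pathsTo (2 * p) m (2 * p - 2 * k)).ncard : ℤ) = (pathPoly m p).coeff k) :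
    ∀ k ≤ p + 1, ((pathsTo (2 * p + 1) m (2 * p + 1 - 2 * k)).ncard : ℤ) =
      (pathPoly m p * (1 + X)).coeff k := by
  intro k hk
  rcases Nat.le_succ_iff.1 hk with hk | rfl
  · have hodd : Odd (2 * p) → 2 * p < 2 * m := fun h => absurd h (by simp)
    rw [ncard_pathsTo_succ_of_imp hodd (by omega), Nat.cast_add, mul_add, mul_one, coeff_add,
      ← hp k hk, show (2 * p + 1 - 2 * k - 1 : ℤ) = 2 * p - 2 * k by ring]
    congr 1
    cases k with
    | zero =>
      rw [coeff_mul_X_zero, pathsTo_of_gt (by push_cast; omega), Set.ncard_empty, Nat.cast_zero]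
    | succ k =>
      rw [coeff_mul_X, ← hp k (by omega)]
      congr 3
      push_cast
      ring
  · rw [coeff_pathPoly_mul_eq_zero, pathsTo_of_neg (by push_cast; omega), Set.ncard_empty,
      Nat.cast_zero]

theorem ncard_pathsTo_even (m p : ℕ) :
    ∀ k ≤ p, ((pathsTo (2 * p) m (2 * p - 2 * k)).ncard : ℤ) = (pathPoly m p).coeff k := by
  induction p with
  | zero =>
    intro k hk
    obtain rfl : k = 0 := by omega
    have h : pathsTo (2 * 0) m (2 * (0 : ℕ) - 2 * (0 : ℕ)) = Set.univ := pathsTo_zero m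
    rw [h]
    simp [pathPoly, Set.ncard_univ]
  | succ p ih =>
    intro k hk
    have hodd := ncard_pathsTo_odd ih
    have h1 : ((pathsTo (2 * p + 1) m (2 * (p + 1 : ℕ) - 2 * k - 1)).ncard : ℤ) =
        (pathPoly m p * (1 + X)).coeff k := by
      rw [← hodd k hk]
      congr 3
      push_cast
      ring
    have h2 : ((pathsTo (2 * p + 1) m (2 * (p + 1 : ℕ) - 2 * k + 1)).ncard : ℤ) =
        (pathPoly m p * (1 + X) * X).coeff k := by
      cases k with
      | zero =>
        rw [coeff_mul_X_zero, pathsTo_of_gt (by push_cast; omega), Set.ncard_empty, Nat.cast_zero]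
      | succ k =>
        rw [coeff_mul_X, ← hodd k (by omega)]
        congr 3
        push_cast
        ring
    have h3 : ((pathsTo (2 * p) m (2 * (p + 1 : ℕ) - 2 * k)).ncard : ℤ) =
        (X * pathPoly m p).coeff k := by
      cases k with
      | zero =>
        rw [coeff_X_mul_zero, pathsTo_of_gt (by push_cast; omega), Set.ncard_empty, Nat.cast_zero]
      | succ k =>
        rw [coeff_X_mul, ← ih k (by omega)]
        congr 3
        push_cast
        ring
    have hh : (0 : ℤ) ≤ 2 * (p + 1 : ℕ) - 2 * k := by push_cast; omega
    -- The two steps pass abscissa `2p + 1`, where a peak is allowed exactly when `p < m`. Otherwise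
    -- the Up-Down pairs, counted by `X * pathPoly m p`, are removed.
    rcases lt_or_ge p m with hpm | hpm
    · have h := ncard_pathsTo_succ_of_imp (n := 2 * p + 1) (m := m) (fun _ => by omega) hh
      rw [pathPoly_succ_of_lt hpm, mul_add _ (1 : ℤ[X]), mul_one, coeff_add, ← h1, ← h2]
      exact_mod_cast h
    · have h := ncard_pathsTo_succ_succ (n := 2 * p) (m := m) (by simp) (by omega) hh
      have hq := congrArg (fun q : ℤ[X] => q.coeff k) (pathPoly_succ_of_le hpm)
      rw [coeff_add, mul_add _ (1 : ℤ[X]), mul_one, coeff_add, ← h1, ← h2, ← h3] at hq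
      rw [show 2 * (p + 1) = 2 * p + 2 by ring]
      omega

end Paths

end TwoRow

theorem mainTheorem9 :
    (∀ ℓ k i : ℕ, k ≤ ℓ → i ≤ ℓ →
      TwoRow.alpha (2 * ℓ) k i = ((TwoRow.restrictedPaths (2 * ℓ) k (ℓ - i)).ncard : ℂ)) ∧
    (∀ ℓ k i : ℕ, k ≤ ℓ → i ≤ ℓ →
      TwoRow.alpha (2 * ℓ + 1) k i =
        ((TwoRow.restrictedPaths (2 * ℓ + 1) k (ℓ - i)).ncard : ℂ)) := by
  constructor
  · intro ℓ k i hk hi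
    rw [TwoRow.alpha_eq_coeff (by omega) (by omega), TwoRow.restrictedPaths_eq]
    have h := TwoRow.ncard_pathsTo_even (ℓ - i) ℓ k hk
    rw [TwoRow.pathPoly, min_eq_right (by omega), Nat.mul_sub, Nat.sub_sub_self hi,
      ← mul_assoc] at h
    rw [← h]
    push_cast
    rfl
  · intro ℓ k i hk hi
    rw [TwoRow.alpha_eq_coeff (by omega) (by omega), TwoRow.restrictedPaths_eq]
    have h := TwoRow.ncard_pathsTo_odd (TwoRow.ncard_pathsTo_even (ℓ - i) ℓ) k (by omega)
    -- The unpaired last step supplies one more factor `1 + X`, raising its exponent from `2 * (ℓ -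
    -- i)` to `n - 2 * i`.
    rw [TwoRow.pathPoly, min_eq_right (by omega), Nat.sub_sub_self hi, ← mul_assoc,
      mul_right_comm, mul_assoc (1 - Polynomial.X), ← pow_succ,
      show 2 * (ℓ - i) + 1 = 2 * ℓ + 1 - 2 * i by omega] at h
    rw [← h]
    push_cast
    rfl
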